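/- Let $f(x)=\sum_{j=1}^n f_j(x)$, $x\in\mathbb R^d$, with $f_j(x)=\mathbb E[g_j(x;\zeta_j)]$, where the $\zeta_j$ are random variables on a probability space. Each of $n$ agents has a deterministic initial point $x_{i,0}\in\mathbb R^d$ and samples $\zeta_{i,0},\zeta_{i,1},\dots$ distributed as $\zeta_i$, the vectors $(\zeta_{1,k},\dots,\zeta_{n,k})$, $k\ge 0$, being independent. For weight matrices $A=(a_{ij})$, $B=(b_{ij})\in\mathbb R^{n\times n}$ and step sizes $\alpha_k>0$, the $\mathcal S$-$\mathcal{AB}$ method is, with $y_{i,0}=\nabla g_i(x_{i,0};\zeta_{i,0})$ and $k=0,1,2,\dots$, $$x_{i,k+1}=\sum_{j=1}^n a_{ij}x_{j,k}-\alpha_k y_{i,k},\qquad y_{i,k+1}=\sum_{j=1}^n b_{ij}y_{j,k}+\nabla g_i(x_{i,k+1};\zeta_{i,k+1})-\nabla g_i(x_{i,k};\zeta_{i,k}).$$ Assumptions on the objective. (i) $f$ is differentiable and $\mu$-strongly convex for some $\mu>0$: $f(y)\ge f(x)+\langle\nabla f(x),y-x\rangle+\frac{\mu}{2}\|x-y\|^2$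 for all $x,y$. (ii) $x^*$ is a minimizer of $f$, $\nabla f$ is differentiable at $x^*$, and for some $c>0$, $\|\nabla f(x)-\nabla^2 f(x^*)(x-x^*)\|\le c\|x-x^*\|^2$ for all $x$. (iii) Each $g_i(\cdot\,;\zeta_i)$ is differentiable, and there are $p>2$, $U_1>0$ and positive random variables $L_i(\zeta_i)$ with $\mathbb E[L_i(\zeta_i)^p]<\infty$ such that, for all $i,x,y$, $\mathbb E\|\nabla g_i(x;\zeta_i)-\nabla f_i(x)\|^p\le U_1^{p/2}$ and $\|\nabla g_i(x;\zeta_i)-\nabla g_i(y;\zeta_i)\|\le L_i(\zeta_i)\|x-y\|$. Put $L=\max_i\sqrt{\mathbb E[L_i(\zeta_i)^2]}$. Assumptions on the weights. $A$ and $B$ are entrywise nonnegative with positive diagonals, $A\mathbf 1=\mathbf 1$ and $\mathbf 1^\top B=\mathbf 1^\top$. For a nonnegative matrix $M$, let $\mathcal G_M$ be the directed graph on $\{1,\dots,n\}$ with an edge from $j$ to $i$ if and only if $M_{ij}>0$; some node is the root of a spanning tree of $\mathcal G_A$ and also the root of a spanning tree of $\mathcal G_{B^\top}$. Let $u,v\ge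 0$ satisfy $u^\top A=u^\top$, $Bv=v$, $u^\top\mathbf 1=\mathbf 1^\top v=n$, and put $\bar x_k=\frac1n\sum_{i=1}^n u_i x_{i,k}$. (1) If $\alpha_k=a/(k+b)^\alpha$ with $\alpha\in(1/2,1)$, $a,b>0$ and $\frac{a}{b^\alpha}\le\min\{1,\frac{n}{u^\top v L}\}$, then $\mathbb E\|\bar x_k-x^*\|^2=O(\alpha_k)$. (2) If $\alpha_k=a/(k+b)$ with $a,b>0$ and $\frac{n^2}{u^\top v\,\mu}<a\le\min\{1,\frac{n}{u^\top vL}\}\,b$, then $\mathbb E\|\bar x_k-x^*\|^2=O(1/k)$, and moreover $\mathbb E\|x_{i,k}-x^*\|^2=O(1/k)$ for every agent $i$. -/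

import Mathlib

open MeasureTheory ProbabilityTheory

noncomputable section

namespace SAB

/-- The decision space `ℝ^d` with the Euclidean norm. -/
abbrev Vec (d : ℕ) : Type := EuclideanSpace ℝ (Fin d)

section Graph

variable {n : ℕ}

/-- The directed graph induced by a nonnegative matrix `M`: there is an edge from `j` to `i`
(agent `i` receives from agent `j`) exactly when `M i j > 0`. -/
def Edge (M : Matrix (Fin n) (Fin n) ℝ) (j i : Fin n) : Prop := 0 < M i j

/-- The map `parent` describes a spanning tree, with root `r`, of the graph induced by `M`: every
node other than `r` is entered by the edge from its parent, and climbing from any node through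
successive parents leads to `r` (the value of `parent` at `r` plays no role). -/
def IsSpanningTree (M : Matrix (Fin n) (Fin n) ℝ) (r : Fin n) (parent : Fin n → Fin n) : Prop :=
  (∀ i, i ≠ r → Edge M (parent i) i) ∧ ∀ i, ∃ m : ℕ, parent^[m] i = r

/-- The set of roots of all spanning trees of the graph induced by `M`. -/
def roots (M : Matrix (Fin n) (Fin n) ℝ) : Set (Fin n) :=
  {r | ∃ parent : Fin n → Fin n, IsSpanningTree M r parent}

/-- Assumption on the weight matrices and the networks. That each of the two graphs contains a
spanning tree is part of `common_root`. -/
structure WeightAssumption (A B : Matrix (Fin n) (Fin n) ℝ) : Prop where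
  A_nonneg : ∀ i j, 0 ≤ A i j
  B_nonneg : ∀ i j, 0 ≤ B i j
  A_row : ∀ i, ∑ j, A i j = 1
  B_col : ∀ j, ∑ i, B i j = 1
  A_diag : ∀ i, 0 < A i i
  B_diag : ∀ i, 0 < B i i
  common_root : (roots A ∩ roots B.transpose).Nonempty

/-- `u` is the nonnegative left eigenvector of `A` for the eigenvalue `1`, scaled to total mass
`n`. -/
structure IsLeftPerron (A : Matrix (Fin n) (Fin n) ℝ) (u : Fin n → ℝ) : Prop where
  nonneg : ∀ i, 0 ≤ u i
  eigen : Matrix.vecMul u A = u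
  mass : ∑ i, u i = n

/-- `v` is the nonnegative right eigenvector of `B` for the eigenvalue `1`, scaled to total mass
`n`. -/
structure IsRightPerron (B : Matrix (Fin n) (Fin n) ℝ) (v : Fin n → ℝ) : Prop where
  nonneg : ∀ i, 0 ≤ v i
  eigen : Matrix.mulVec B v = v
  mass : ∑ i, v i = n

end Graph

section Objective

variable {n d : ℕ} {Ω : Type*} [MeasurableSpace Ω] {Z : Fin n → Type*}

/-- The cost `f_i(x) = E[g_i(x; ζ_i)]` of agent `i`. -/
def localCost (P : Measure Ω) (g : (i : Fin n) → Vec d → Z i → ℝ) (ζ : (i : Fin n) → Ω → Z i)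
    (i : Fin n) (x : Vec d) : ℝ :=
  ∫ ω, g i x (ζ i ω) ∂P

/-- The global objective `f = ∑ f_j`. -/
def cost (P : Measure Ω) (g : (i : Fin n) → Vec d → Z i → ℝ) (ζ : (i : Fin n) → Ω → Z i)
    (x : Vec d) : ℝ :=
  ∑ j, localCost P g ζ j x

/-- The stochastic gradient `∇g_i(x; z)`, with respect to `x`. -/
def stochGrad (g : (i : Fin n) → Vec d → Z i → ℝ) (i : Fin n) (x : Vec d) (z : Z i) : Vec d :=
  gradient (fun x' => g i x' z) x

/-- The constant `L = max_i sqrt (E[L_i(ζ_i)^2])`. -/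
def lipConst (P : Measure Ω) (ζ : (i : Fin n) → Ω → Z i) (ℓ : (i : Fin n) → Z i → ℝ) : ℝ :=
  ⨆ i : Fin n, Real.sqrt (∫ ω, (ℓ i (ζ i ω)) ^ 2 ∂P)

/-- Assumption on the objective: `f` is differentiable and `μ`-strongly convex, `xstar` is an
optimal solution near which `∇f` has a quadratically accurate linearization, and the stochastic
gradients have a uniformly bounded central moment of an order `p > 2` and random Lipschitz
constants `ℓ i` with finite `p`-th moment. The fields `g_meas`, `ζ_meas`, `ℓ_meas` and
`g_integrable` say that the random quantities and the expectations `f_i(x)` make sense. -/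
structure ObjectiveAssumption [∀ i, MeasurableSpace (Z i)] (P : Measure Ω)
    (g : (i : Fin n) → Vec d → Z i → ℝ) (ζ : (i : Fin n) → Ω → Z i)
    (ℓ : (i : Fin n) → Z i → ℝ) (μ : ℝ) (xstar : Vec d) : Prop where
  ζ_meas : ∀ i, Measurable (ζ i)
  g_meas : ∀ i x, Measurable (g i x)
  ℓ_meas : ∀ i, Measurable (ℓ i)
  g_integrable : ∀ i x, Integrable (fun ω => g i x (ζ i ω)) P
  μ_pos : 0 < μ
  cost_diff : Differentiable ℝ (cost P g ζ)
  strong_convex : ∀ x y : Vec d,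
    cost P g ζ x + inner ℝ (gradient (cost P g ζ) x) (y - x) + μ / 2 * ‖x - y‖ ^ 2
      ≤ cost P g ζ y
  optimal : ∀ x, cost P g ζ xstar ≤ cost P g ζ x
  hessian_exists : DifferentiableAt ℝ (gradient (cost P g ζ)) xstar
  hessian_bound : ∃ c : ℝ, 0 < c ∧ ∀ x : Vec d,
    ‖gradient (cost P g ζ) x - fderiv ℝ (gradient (cost P g ζ)) xstar (x - xstar)‖
      ≤ c * ‖x - xstar‖ ^ 2
  g_diff : ∀ i z, Differentiable ℝ (fun x => g i x z)
  moments : ∃ p U₁ : ℝ, 2 < p ∧ 0 < U₁ ∧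
    (∀ i x,
      Integrable (fun ω => ‖stochGrad g i x (ζ i ω) - gradient (localCost P g ζ i) x‖ ^ p) P ∧
      ∫ ω, ‖stochGrad g i x (ζ i ω) - gradient (localCost P g ζ i) x‖ ^ p ∂P ≤ U₁ ^ (p / 2)) ∧
    ∀ i, Integrable (fun ω => (ℓ i (ζ i ω)) ^ p) P
  ℓ_pos : ∀ i z, 0 < ℓ i z
  lipschitz : ∀ i z (x y : Vec d),
    ‖stochGrad g i x z - stochGrad g i y z‖ ≤ ℓ i z * ‖x - y‖

/-- The sample streams: `s i k` is the sample `ζ_{i,k}` drawn by agent `i` at time `k`. It has the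
law of `ζ i`, and the samples drawn at different times are independent (samples drawn by different
agents at the same time may be dependent). -/
structure IsSampling [∀ i, MeasurableSpace (Z i)] (P : Measure Ω)
    (ζ : (i : Fin n) → Ω → Z i) (s : (i : Fin n) → ℕ → Ω → Z i) : Prop where
  meas : ∀ i k, Measurable (s i k)
  law : ∀ i k, IdentDistrib (s i k) (ζ i) P P
  indep : iIndepFun (fun (k : ℕ) (ω : Ω) (i : Fin n) => s i k ω) P

/-- The pair `(x_k, y_k)` produced by the algorithm along the realized samples `z i k`:
`x_{i,k+1} = ∑ a_ij x_{j,k} - α_k y_{i,k}` and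
`y_{i,k+1} = ∑ b_ij y_{j,k} + ∇g_i(x_{i,k+1}; z_{i,k+1}) - ∇g_i(x_{i,k}; z_{i,k})`,
with `y_{i,0} = ∇g_i(x_{i,0}; z_{i,0})`. -/
def iter (A B : Matrix (Fin n) (Fin n) ℝ) (g : (i : Fin n) → Vec d → Z i → ℝ) (α : ℕ → ℝ)
    (x0 : Fin n → Vec d) (z : (i : Fin n) → ℕ → Z i) : ℕ → (Fin n → Vec d) × (Fin n → Vec d)
  | 0 => (x0, fun i => stochGrad g i (x0 i) (z i 0))
  | k + 1 =>
    let x := (iter A B g α x0 z k).1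
    let y := (iter A B g α x0 z k).2
    let x' : Fin n → Vec d := fun i => ∑ j, A i j • x j - α k • y i
    (x', fun i => ∑ j, B i j • y j + stochGrad g i (x' i) (z i (k + 1))
      - stochGrad g i (x i) (z i k))

/-- The random iterate `x_{i,k}` of agent `i`. -/
def agent (A B : Matrix (Fin n) (Fin n) ℝ) (g : (i : Fin n) → Vec d → Z i → ℝ) (α : ℕ → ℝ)
    (x0 : Fin n → Vec d) (s : (i : Fin n) → ℕ → Ω → Z i) (i : Fin n) (k : ℕ) (ω : Ω) : Vec d :=
  (iter A B g α x0 (fun j t => s j t ω) k).1 i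

/-- The weighted average `x̄_k = (1/n) ∑ u_i x_{i,k}`. -/
def avg (A B : Matrix (Fin n) (Fin n) ℝ) (u : Fin n → ℝ) (g : (i : Fin n) → Vec d → Z i → ℝ)
    (α : ℕ → ℝ) (x0 : Fin n → Vec d) (s : (i : Fin n) → ℕ → Ω → Z i) (k : ℕ) (ω : Ω) : Vec d :=
  (1 / (n : ℝ)) • ∑ i, u i • agent A B g α x0 s i k ω

end Objective

/-- `E‖X_k - xstar‖² = O(r_k)` over the times `k ≥ k₀`: the second moments are finite and bounded
by a constant multiple of `r_k`. -/
def MeanSquareRate {d : ℕ} {Ω : Type*} [MeasurableSpace Ω] (P : Measure Ω)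
    (X : ℕ → Ω → Vec d) (xstar : Vec d) (r : ℕ → ℝ) (k₀ : ℕ) : Prop :=
  (∀ k, Integrable (fun ω => ‖X k ω - xstar‖ ^ 2) P) ∧
  ∃ C : ℝ, 0 < C ∧ ∀ k, k₀ ≤ k → ∫ ω, ‖X k ω - xstar‖ ^ 2 ∂P ≤ C * r k

end SAB

end

/-! Write the trackers as `y = w + G`, where `G` stacks the stochastic gradients sampled at time
`k`. The residual `w` sums to zero and depends only on samples drawn before time `k`, and the method
becomes `x' = A x - α (w + G)`, `w' = B (w + G) - G`. A Doeblin argument at the common root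
(`exists_pow_sub_spread_small`) makes high powers of `A - 1uᵀ/n` and `B - v1ᵀ/n` small. Hence in
adapted norms (`exists_contractingNorm`) the deviation of the agents from their average and the
residual both contract by fixed factors.

The difficulty is that the average moves along `uᵀ(w + G)`, not along the sum of the gradients, and
`w` need not vanish, since it keeps receiving gradient noise. A vector `h` with `hᵀB = hᵀ - uᵀ +
(u·v/n) 1ᵀ` (`exists_correction`) turns the unwanted part into a telescoping difference. The
corrected average `x̄ - (α/n) h·w` then makes a stochastic gradient step of length `α (u·v)/n²`, up
to an error proportional to `α_k - α_{k+1} = O(α_k²)` (`corrected_avg_step`). Being a function of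
the past, it is uncorrelated with the fresh noise (`integral_inner_noise`), which therefore costs
only `O(α²)` in mean square.

The squared corrected error, the squared deviation and `K α²` times the squared residual add up to a
Lyapunov function `V` (`exists_lyapunov_step`) with `E V_{k+1} ≤ (1 - m α_k) E V_k + C α_k²`, where
`m = μ (u·v)/n²`. This gives `E V_k = O(α_k)` as soon as `α_k - α_{k+1} ≤ m' α_k²` eventually, for
some `m' < m` (`exists_le_mul_of_recursion`). For exponents below one the decrement is `o(α_k²)`;
for `a/(k+b)` it is at most `α_k²/a`, and the lower bound on `a` says exactly that `1/a < m`. -/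

noncomputable section

namespace SAB

/-! ### Matrices acting on stacks of vectors, and adapted norms -/

section MatrixAction

variable {n : ℕ} {E : Type*} [NormedAddCommGroup E] [NormedSpace ℝ E]

/-- The action of an `n × n` matrix on stacks of `n` vectors, `(M x)_i = ∑ j, M_ij x_j`. -/
def act (M : Matrix (Fin n) (Fin n) ℝ) : (Fin n → E) →ₗ[ℝ] (Fin n → E) where
  toFun x i := ∑ j, M i j • x j
  map_add' x y := by ext i; simp [Finset.sum_add_distrib]
  map_smul' c x := by ext i; simp [Finset.smul_sum, smul_comm c]

lemma act_apply (M : Matrix (Fin n) (Fin n) ℝ) (x : Fin n → E) (i : Fin n) :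
    act M x i = ∑ j, M i j • x j := rfl

lemma act_mul (M N : Matrix (Fin n) (Fin n) ℝ) (x : Fin n → E) :
    act (M * N) x = act M (act N x) := by
  ext i
  simp only [act_apply, Matrix.mul_apply, Finset.sum_smul, Finset.smul_sum, smul_smul]
  exact Finset.sum_comm

lemma act_one (x : Fin n → E) : act (1 : Matrix (Fin n) (Fin n) ℝ) x = x := by
  ext i
  simp [act_apply, Matrix.one_apply]

lemma norm_act_le (M : Matrix (Fin n) (Fin n) ℝ) {c : ℝ} (hc : 0 ≤ c)
    (hM : ∀ i, ∑ j, |M i j| ≤ c) (x : Fin n → E) : ‖act M x‖ ≤ c * ‖x‖ := by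
  refine (pi_norm_le_iff_of_nonneg (by positivity)).2 fun i => ?_
  rw [act_apply]
  calc ‖∑ j, M i j • x j‖ ≤ ∑ j, ‖M i j • x j‖ := norm_sum_le _ _
    _ ≤ ∑ j, |M i j| * ‖x‖ := by
        gcongr with j
        rw [norm_smul, Real.norm_eq_abs]
        gcongr
        exact norm_le_pi_norm x j
    _ = (∑ j, |M i j|) * ‖x‖ := by rw [Finset.sum_mul]
    _ ≤ c * ‖x‖ := by gcongr; exact hM i

lemma exists_norm_act_le (M : Matrix (Fin n) (Fin n) ℝ) :
    ∃ c, 0 ≤ c ∧ ∀ x : Fin n → E, ‖act M x‖ ≤ c * ‖x‖ :=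
  ⟨∑ i, ∑ j, |M i j|, by positivity, norm_act_le M (by positivity) fun i =>
    Finset.single_le_sum (f := fun i => ∑ j, |M i j|) (fun _ _ => by positivity)
      (Finset.mem_univ i)⟩

lemma continuous_act (M : Matrix (Fin n) (Fin n) ℝ) :
    Continuous fun x : Fin n → E => act M x := by
  simp only [funext fun x : Fin n → E => funext (act_apply M x)]
  fun_prop

/-- `N` is equivalent to the sup norm, and `M` contracts it by a factor less than one. -/
structure IsContractingNorm (M : Matrix (Fin n) (Fin n) ℝ) (N : (Fin n → E) → ℝ) (ρ C : ℝ) :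
    Prop where
  cont : Continuous N
  rate_pos : 0 < ρ
  rate_le : ρ ≤ 1
  const_pos : 0 < C
  lower : ∀ x, ‖x‖ ≤ N x
  upper : ∀ x, N x ≤ C * ‖x‖
  contract : ∀ x y, N (act M x + y) ≤ (1 - ρ) * N x + C * ‖y‖

/-- The norm is twice the orbit sum `∑_{k<m} ‖M^k x‖`. Applying `M` shifts the sum, trading `2‖x‖`
for `2‖M^m x‖ ≤ ‖x‖`, a net loss of at least `‖x‖ ≥ N x / C`; hence the rate `1 / C`. -/
lemma exists_contractingNorm (M : Matrix (Fin n) (Fin n) ℝ) {m : ℕ}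
    (hM : ∀ i, ∑ j, |(M ^ m) i j| ≤ 1 / 2) :
    ∃ (N : (Fin n → E) → ℝ) (ρ C : ℝ), IsContractingNorm M N ρ C := by
  choose c hc0 hc using fun k => exists_norm_act_le (E := E) (M ^ k)
  set N : (Fin n → E) → ℝ := fun x => 2 * ∑ k ∈ Finset.range m, ‖act (M ^ k) x‖ with hN
  set C : ℝ := 1 + 2 * ∑ k ∈ Finset.range m, c k with hC
  have hsum0 : 0 ≤ ∑ k ∈ Finset.range m, c k := Finset.sum_nonneg fun k _ => hc0 k
  have hC1 : 1 ≤ C := by linarith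
  have hC0 : 0 < C := by linarith
  have upper : ∀ x, N x ≤ C * ‖x‖ := fun x => by
    have : ∑ k ∈ Finset.range m, ‖act (M ^ k) x‖ ≤ (∑ k ∈ Finset.range m, c k) * ‖x‖ := by
      rw [Finset.sum_mul]
      exact Finset.sum_le_sum fun k _ => hc k x
    have := norm_nonneg x
    simp only [hN, hC]
    linarith
  have add_le : ∀ x y, N (x + y) ≤ N x + N y := fun x y => by
    simp only [hN]
    rw [← mul_add, ← Finset.sum_add_distrib]
    gcongr
    rw [map_add]
    exact norm_add_le _ _
  have half : ∀ x : Fin n → E, ‖act (M ^ m) x‖ ≤ 1 / 2 * ‖x‖ :=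
    norm_act_le _ (by norm_num) hM
  have step : ∀ x, N (act M x) ≤ N x - ‖x‖ := fun x => by
    have h := Finset.sum_range_succ' (fun k => ‖act (M ^ k) x‖) m
    rw [Finset.sum_range_succ] at h
    simp only [pow_succ, act_mul, pow_zero, act_one] at h
    have := half x
    simp only [hN]
    linarith
  -- The decrease by `‖x‖` cannot make `N` negative.
  have lower : ∀ x, ‖x‖ ≤ N x := fun x => by
    have : 0 ≤ N (act M x) := by simp only [hN]; positivity
    linarith [step x]
  refine ⟨N, 1 / C, C, ?_, by positivity, (div_le_one hC0).2 hC1, hC0, lower, upper, ?_⟩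
  · exact continuous_const.mul (continuous_finsetSum _ fun k _ => (continuous_act (M ^ k)).norm)
  · intro x y
    have h1 : 1 / C * N x ≤ ‖x‖ := by
      rw [div_mul_eq_mul_div, one_mul, div_le_iff₀ hC0, mul_comm]
      exact upper x
    linarith [add_le (act M x) y, step x, upper y]

end MatrixAction

/-! ### Doeblin contraction for column-stochastic matrices -/

section Doeblin

variable {n : ℕ}

/-- Subtracting `δ` from row `r` does not change the action on zero-sum vectors, and leaves a
nonnegative matrix whose columns sum to `1 - δ`. -/
lemma sum_abs_mulVec_le {M : Matrix (Fin n) (Fin n) ℝ} (h0 : ∀ i j, 0 ≤ M i j)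
    (h1 : ∀ j, ∑ i, M i j = 1) {r : Fin n} {δ : ℝ} (hδ : ∀ j, δ ≤ M r j) {w : Fin n → ℝ}
    (hw : ∑ j, w j = 0) : ∑ i, |M.mulVec w i| ≤ (1 - δ) * ∑ j, |w j| := by
  have key : ∀ i, |M.mulVec w i| ≤ ∑ j, (M i j - if i = r then δ else 0) * |w j| := by
    intro i
    have : M.mulVec w i = ∑ j, (M i j - if i = r then δ else 0) * w j := by
      simp only [sub_mul, Finset.sum_sub_distrib, ← Finset.mul_sum, hw]
      simp [Matrix.mulVec, dotProduct]
    rw [this]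
    refine (Finset.abs_sum_le_sum_abs _ _).trans_eq (Finset.sum_congr rfl fun j _ => ?_)
    rw [abs_mul, abs_of_nonneg (a := M i j - _)]
    split_ifs with h
    · subst h; linarith [hδ j]
    · simpa using h0 i j
  refine (Finset.sum_le_sum fun i _ => key i).trans_eq ?_
  rw [Finset.sum_comm, Finset.mul_sum]
  refine Finset.sum_congr rfl fun j _ => ?_
  rw [← Finset.sum_mul, Finset.sum_sub_distrib, h1]
  simp

lemma sum_mulVec {M : Matrix (Fin n) (Fin n) ℝ} (h1 : ∀ j, ∑ i, M i j = 1) (w : Fin n → ℝ) :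
    ∑ i, M.mulVec w i = ∑ j, w j := by
  simp only [Matrix.mulVec, dotProduct]
  rw [Finset.sum_comm]
  simp [← Finset.sum_mul, h1]

lemma colStochastic_pow {M : Matrix (Fin n) (Fin n) ℝ} (h0 : ∀ i j, 0 ≤ M i j)
    (h1 : ∀ j, ∑ i, M i j = 1) (k : ℕ) :
    (∀ i j, 0 ≤ (M ^ k) i j) ∧ ∀ j, ∑ i, (M ^ k) i j = 1 := by
  induction k with
  | zero =>
    refine ⟨fun i j => ?_, fun j => ?_⟩
    · rw [pow_zero, Matrix.one_apply]; split_ifs <;> norm_num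
    · simp [Matrix.one_apply]
  | succ k ih =>
    rw [pow_succ]
    refine ⟨fun i j => ?_, fun j => ?_⟩
    · rw [Matrix.mul_apply]
      exact Finset.sum_nonneg fun l _ => mul_nonneg (ih.1 i l) (h0 l j)
    simp only [Matrix.mul_apply]
    rw [Finset.sum_comm]
    simp [← Finset.sum_mul, ih.2, h1]

/-- A column-stochastic matrix with positive diagonal, whose transpose has a spanning tree rooted
at `r`, has a power whose row `r` is positive. -/
lemma exists_pow_row_pos {M : Matrix (Fin n) (Fin n) ℝ} (h0 : ∀ i j, 0 ≤ M i j)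
    (h1 : ∀ j, ∑ i, M i j = 1) (hd : ∀ i, 0 < M i i) {r : Fin n}
    (hr : r ∈ roots M.transpose) : ∃ m, ∀ j, 0 < (M ^ (m + 1)) r j := by
  obtain ⟨parent, he, hp⟩ := hr
  have grow : ∀ m k j, parent^[m] j = r → m ≤ k → 0 < (M ^ k) r j := by
    intro m k
    induction k generalizing m with
    | zero =>
      intro j hj hm
      obtain rfl : m = 0 := by omega
      simp only [Function.iterate_zero, id] at hj
      simp [hj]
    | succ k ih =>
      intro j hj hm
      have pos : ∀ l, 0 < (M ^ k) r l → 0 < M l j → 0 < (M ^ (k + 1)) r j := by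
        intro l hl hlj
        rw [pow_succ, Matrix.mul_apply]
        exact Finset.sum_pos' (fun l _ => mul_nonneg ((colStochastic_pow h0 h1 k).1 r l) (h0 l j))
          ⟨l, Finset.mem_univ l, mul_pos hl hlj⟩
      -- Paths shorter than `k` are padded with the loop at the root, where the diagonal is
      -- positive.
      by_cases hjr : j = r
      · exact pos j (ih 0 j hjr (Nat.zero_le k)) (hd j)
      · obtain _ | m := m
        · exact absurd hj hjr
        · exact pos (parent j) (ih m _ hj (by omega)) (he j hjr)
  choose m hm using hp
  -- The sum of all depths serves every node at once; the exponent is kept positive because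
  -- `sub_spread_pow` needs a nonzero power.
  exact ⟨∑ j, m j, fun j => grow (m j) _ j (hm j)
    ((Finset.single_le_sum (fun _ _ => Nat.zero_le _) (Finset.mem_univ j)).trans
      (Nat.le_succ _))⟩

/-- The rank-one matrix `w 1ᵀ / n`. -/
def spread (w : Fin n → ℝ) : Matrix (Fin n) (Fin n) ℝ := Matrix.of fun i _ => w i / n

/-- The matrix `S = w1ᵀ/n` satisfies `MS = SM = S² = S`, so all mixed terms collapse. -/
lemma sub_spread_pow {M : Matrix (Fin n) (Fin n) ℝ} (h1 : ∀ j, ∑ i, M i j = 1) {w : Fin n → ℝ}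
    (hw : M.mulVec w = w) (hm : ∑ i, w i = n) (hn : 0 < n) (k : ℕ) :
    (M - spread w) ^ (k + 1) = M ^ (k + 1) - spread w := by
  have hn' : (n : ℝ) ≠ 0 := by positivity
  have a1 : M * spread w = spread w := by
    ext i j
    have := congrFun hw i
    simp only [Matrix.mulVec, dotProduct] at this
    simp only [Matrix.mul_apply, spread, Matrix.of_apply, ← mul_div_assoc, ← Finset.sum_div, this]
  have a2 : spread w * M = spread w := by
    ext i j
    simp only [Matrix.mul_apply, spread, Matrix.of_apply, ← Finset.mul_sum, h1, mul_one]
  have a3 : spread w * spread w = spread w := by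
    ext i j
    simp only [Matrix.mul_apply, spread, Matrix.of_apply, ← Finset.mul_sum, ← Finset.sum_div, hm]
    field_simp
  have a4 : ∀ k, M ^ k * spread w = spread w := by
    intro k
    induction k with
    | zero => simp
    | succ k ih => rw [pow_succ, mul_assoc, a1, ih]
  induction k with
  | zero => simp
  | succ k ih =>
    rw [pow_succ, ih, sub_mul, mul_sub, mul_sub, ← pow_succ, a2, a3, a4]
    abel

lemma exists_pow_sub_spread_small {M : Matrix (Fin n) (Fin n) ℝ} (h0 : ∀ i j, 0 ≤ M i j)
    (h1 : ∀ j, ∑ i, M i j = 1) (hd : ∀ i, 0 < M i i) {r : Fin n}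
    (hr : r ∈ roots M.transpose) {w : Fin n → ℝ} (hw : M.mulVec w = w) (hm : ∑ i, w i = n)
    {ε : ℝ} (hε : 0 < ε) : ∃ k, ∀ i j, |((M - spread w) ^ k) i j| ≤ ε := by
  have hn : 0 < n := r.pos
  have hn' : (n : ℝ) ≠ 0 := by positivity
  obtain ⟨m', hmpos⟩ := exists_pow_row_pos h0 h1 hd hr
  set m := m' + 1 with hm'
  obtain ⟨j₀, -, hj₀⟩ := Finset.exists_min_image Finset.univ (fun j => (M ^ m) r j) ⟨r, by simp⟩
  set δ := (M ^ m) r j₀ with hδ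
  obtain ⟨p0, p1⟩ := colStochastic_pow h0 h1 m
  have hδ0 : 0 < δ := hmpos j₀
  have hδ1 : δ ≤ 1 := (p1 j₀) ▸ Finset.single_le_sum (f := fun i => (M ^ m) i j₀)
    (fun i _ => p0 i j₀) (Finset.mem_univ r)
  have decay : ∀ (z : Fin n → ℝ), ∑ j, z j = 0 → ∀ k,
      ∑ i, |((M ^ m) ^ k).mulVec z i| ≤ (1 - δ) ^ k * ∑ j, |z j| := by
    intro z hz k
    induction k with
    | zero => simp
    | succ k ih =>
      have hz' : ∑ j, ((M ^ m) ^ k).mulVec z j = 0 := by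
        rw [sum_mulVec (colStochastic_pow p0 p1 k).2, hz]
      have := sum_abs_mulVec_le p0 p1 (fun j => hj₀ j (Finset.mem_univ j)) hz'
      rw [Matrix.mulVec_mulVec, ← pow_succ'] at this
      calc _ ≤ _ := this
        _ ≤ (1 - δ) * ((1 - δ) ^ k * ∑ j, |z j|) := by gcongr
        _ = _ := by ring
  -- Since `w` is fixed by `M`, column `j` of `M^q - w1ᵀ/n` is `M^q` applied to `e_j - w/n`, a
  -- zero-sum vector to which `decay` applies.
  set z : Fin n → Fin n → ℝ := fun j i => (1 : Matrix (Fin n) (Fin n) ℝ) i j - w i / n with hz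
  have hz0 : ∀ j, ∑ i, z j i = 0 := fun j => by
    simp only [hz, Finset.sum_sub_distrib, ← Finset.sum_div, hm, Matrix.one_apply]
    simp [div_self hn']
  set K : ℝ := ∑ j, ∑ i, |z j i| with hK
  have hK0 : 0 ≤ K := by positivity
  obtain ⟨k, hk⟩ := exists_pow_lt_of_lt_one (show 0 < ε / (K + 1) by positivity)
    (show 1 - δ < 1 by linarith)
  have hmk : (M ^ m) ^ (k + 1) * spread w = spread w := by
    ext i j
    have fixed : ∀ q, (M ^ q).mulVec w = w := fun q => by
      induction q with
      | zero => simp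
      | succ q ih => rw [pow_succ, ← Matrix.mulVec_mulVec, hw, ih]
    have := congrFun (fixed (m * (k + 1))) i
    rw [pow_mul] at this
    simp only [Matrix.mulVec, dotProduct] at this
    simp only [Matrix.mul_apply, spread, Matrix.of_apply, ← mul_div_assoc, ← Finset.sum_div, this]
  obtain ⟨q, hq⟩ : ∃ q, m * (k + 1) = q + 1 :=
    Nat.exists_eq_succ_of_ne_zero (Nat.mul_ne_zero (Nat.succ_ne_zero m') (Nat.succ_ne_zero k))
  refine ⟨m * (k + 1), fun i j => ?_⟩
  rw [hq, sub_spread_pow h1 hw hm hn, ← hq, pow_mul, Matrix.sub_apply]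
  have entry : ((M ^ m) ^ (k + 1)) i j - spread w i j = ((M ^ m) ^ (k + 1)).mulVec (z j) i := by
    have h2 := congrFun (congrFun hmk i) j
    rw [Matrix.mul_apply] at h2
    simp only [hz, Matrix.mulVec, dotProduct, mul_sub, Finset.sum_sub_distrib]
    rw [← Matrix.mul_apply, mul_one, ← h2]
    rfl
  rw [entry]
  calc |((M ^ m) ^ (k + 1)).mulVec (z j) i|
      ≤ ∑ i, |((M ^ m) ^ (k + 1)).mulVec (z j) i| :=
        Finset.single_le_sum (f := fun i => |((M ^ m) ^ (k + 1)).mulVec (z j) i|)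
          (fun _ _ => abs_nonneg _) (Finset.mem_univ i)
    _ ≤ (1 - δ) ^ (k + 1) * ∑ i, |z j i| := decay _ (hz0 j) _
    _ ≤ (1 - δ) ^ k * K := by
        have e1 : (1 - δ) ^ (k + 1) ≤ (1 - δ) ^ k :=
          pow_le_pow_of_le_one (by linarith) (by linarith) (Nat.le_succ k)
        have e2 : ∑ i, |z j i| ≤ K := Finset.single_le_sum (f := fun j => ∑ i, |z j i|)
          (fun _ _ => by positivity) (Finset.mem_univ j)
        gcongr
    _ ≤ ε / (K + 1) * (K + 1) := by gcongr; linarith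
    _ = ε := by field_simp

end Doeblin

/-! ### Consequences for the weight matrices -/

section Weights

variable {n : ℕ} {A B : Matrix (Fin n) (Fin n) ℝ} {u v : Fin n → ℝ} {E : Type*}
  [NormedAddCommGroup E] [NormedSpace ℝ E]

lemma WeightAssumption.pos (hAB : WeightAssumption A B) : 0 < n :=
  hAB.common_root.some.pos

lemma row_sum_le_half {M : Matrix (Fin n) (Fin n) ℝ} (hn : 0 < n)
    (h : ∀ i j, |M i j| ≤ 1 / (2 * n)) (i : Fin n) : ∑ j, |M i j| ≤ 1 / 2 := by
  refine (Finset.sum_le_sum fun j _ => h i j).trans_eq ?_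
  rw [Finset.sum_const, Finset.card_univ, Fintype.card_fin, nsmul_eq_mul]
  field_simp

lemma exists_pow_sum_le_B (hAB : WeightAssumption A B) (hv : IsRightPerron B v) :
    ∃ k, ∀ i, ∑ j, |((B - spread v) ^ k) i j| ≤ 1 / 2 := by
  have hn := hAB.pos
  obtain ⟨r, -, hr⟩ := hAB.common_root
  obtain ⟨k, hk⟩ := exists_pow_sub_spread_small hAB.B_nonneg hAB.B_col hAB.B_diag hr hv.eigen
    hv.mass (ε := 1 / (2 * n)) (by positivity)
  exact ⟨k, row_sum_le_half hn hk⟩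

lemma exists_pow_sum_le_A (hAB : WeightAssumption A B) (hu : IsLeftPerron A u) :
    ∃ k, ∀ i, ∑ j, |((A - (spread u).transpose) ^ k) i j| ≤ 1 / 2 := by
  have hn := hAB.pos
  obtain ⟨r, hr, -⟩ := hAB.common_root
  obtain ⟨k, hk⟩ := exists_pow_sub_spread_small (M := A.transpose) (fun i j => hAB.A_nonneg j i)
    hAB.A_row hAB.A_diag hr (by rw [Matrix.mulVec_transpose, hu.eigen])
    hu.mass (ε := 1 / (2 * n)) (by positivity)
  refine ⟨k, row_sum_le_half hn fun i j => ?_⟩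
  rw [← Matrix.transpose_transpose A, ← Matrix.transpose_sub, ← Matrix.transpose_pow,
    Matrix.transpose_apply]
  exact hk j i

/-- The common root carries positive mass under both Perron vectors. -/
lemma dotProduct_pos (hAB : WeightAssumption A B) (hu : IsLeftPerron A u)
    (hv : IsRightPerron B v) : 0 < dotProduct u v := by
  have hn := hAB.pos
  have reach : ∀ (M : Matrix (Fin n) (Fin n) ℝ) (w : Fin n → ℝ) (r : Fin n),
      r ∈ roots M.transpose → (∀ i j, 0 ≤ M i j) → (∀ i, 0 ≤ w i) → M.mulVec w = w →
      ∑ i, w i = n → 0 < w r := by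
    rintro M w r ⟨parent, he, hp⟩ h0 hw0 hw hm
    have climb : ∀ m j, 0 < w j → parent^[m] j = r → 0 < w r := by
      intro m
      induction m with
      | zero => intro j hj hjr; simpa [← hjr] using hj
      | succ m ih =>
        intro j hj hjr
        by_cases h : j = r
        · rwa [← h]
        · refine ih (parent j) ?_ hjr
          rw [← congrFun hw (parent j), Matrix.mulVec, dotProduct]
          exact Finset.sum_pos' (fun l _ => mul_nonneg (h0 _ l) (hw0 l))
            ⟨j, Finset.mem_univ j, mul_pos (he j h) hj⟩
    obtain ⟨j, -, hj⟩ : ∃ j ∈ Finset.univ, 0 < w j := by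
      apply Finset.exists_lt_of_sum_lt (f := fun _ => 0)
      rw [hm]
      simpa using hn
    obtain ⟨m, hjm⟩ := hp j
    exact climb m j hj hjm
  obtain ⟨r, hrA, hrB⟩ := hAB.common_root
  refine Finset.sum_pos' (fun i _ => mul_nonneg (hu.nonneg i) (hv.nonneg i))
    ⟨r, Finset.mem_univ r, mul_pos ?_ ?_⟩
  · exact reach A.transpose u r hrA (fun i j => hAB.A_nonneg j i) hu.nonneg
      (by rw [Matrix.mulVec_transpose, hu.eigen]) hu.mass
  · exact reach B v r hrB hAB.B_nonneg hv.nonneg hv.eigen hv.mass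

/-- The weights of the correction that makes the tracking noise telescope. -/
lemma exists_correction (hAB : WeightAssumption A B) (u : Fin n → ℝ)
    (hv : IsRightPerron B v) :
    ∃ h : Fin n → ℝ, ∀ j, ∑ i, h i * B i j = h j - u j + dotProduct u v / n := by
  have hn := hAB.pos
  have hn' : (n : ℝ) ≠ 0 := by positivity
  obtain ⟨k, hk⟩ := exists_pow_sum_le_B hAB hv
  set T := B - spread v with hT
  -- A fixed vector of `T` is fixed by `T ^ k`, which halves norms. Thus `1 - T` is invertible, and
  -- `h` is obtained by solving `hᵀ(1 - T) = uᵀ`.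
  have inj : ∀ x : Fin n → ℝ, T.mulVec x = x → x = 0 := by
    intro x hx
    have fixed : (T ^ k).mulVec x = x := by
      clear hk
      induction k with
      | zero => simp
      | succ k ih => rw [pow_succ, ← Matrix.mulVec_mulVec, hx, ih]
    have := norm_act_le (T ^ k) (by norm_num) hk x
    have e : act (T ^ k) x = x := by
      ext i; rw [← congrFun fixed i]; simp [act_apply, Matrix.mulVec, dotProduct]
    rw [e] at this
    have := norm_nonneg x
    exact norm_eq_zero.1 (by linarith)
  have unit : IsUnit (1 - T) := by
    rw [← Matrix.mulVec_injective_iff_isUnit]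
    intro x y hxy
    have : T.mulVec (x - y) = x - y := by
      simp only [Matrix.sub_mulVec, Matrix.one_mulVec] at hxy
      rw [Matrix.mulVec_sub]
      ext i
      have := congrFun hxy i
      simp only [Pi.sub_apply] at this ⊢
      linarith
    exact sub_eq_zero.1 (inj _ this)
  obtain ⟨h, hh⟩ : ∃ h, Matrix.vecMul h (1 - T) = u := by
    refine ⟨Matrix.vecMul u (1 - T)⁻¹, ?_⟩
    rw [Matrix.vecMul_vecMul, Matrix.nonsing_inv_mul _ ((Matrix.isUnit_iff_isUnit_det _).1 unit),
      Matrix.vecMul_one]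
  have eq : ∀ j, h j - ∑ i, h i * B i j + dotProduct h v / n = u j := by
    intro j
    rw [← congrFun hh j]
    simp only [hT, Matrix.vecMul_sub, Matrix.vecMul_one, Pi.sub_apply]
    simp only [Matrix.vecMul, dotProduct, spread, Matrix.of_apply, ← mul_div_assoc,
      ← Finset.sum_div]
    ring
  -- Pairing `eq` with `v` identifies the constant: `Bv = v` cancels the first two terms and `1ᵀv =
  -- n` cancels the denominator.
  have hv' : dotProduct h v = dotProduct u v := by
    have e1 : dotProduct u v = ∑ j, (h j - ∑ i, h i * B i j + dotProduct h v / n) * v j := by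
      simp only [eq]; rfl
    have e2 : ∑ j, (∑ i, h i * B i j) * v j = dotProduct h v := by
      conv_rhs => rw [← hv.eigen]
      rw [Matrix.dotProduct_mulVec]
      rfl
    simp only [add_mul, sub_mul, Finset.sum_add_distrib, Finset.sum_sub_distrib, e2,
      ← Finset.mul_sum, hv.mass] at e1
    rw [e1]
    simp only [dotProduct]
    field_simp
    ring
  exact ⟨h, fun j => by rw [← hv']; linarith [eq j]⟩

end Weights

/-! ### Exact one-step identities -/

section Identities

variable {n : ℕ} {E : Type*} [NormedAddCommGroup E] [NormedSpace ℝ E]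
  {A B : Matrix (Fin n) (Fin n) ℝ} {u v : Fin n → ℝ}

/-- The average of a stack with weights `u / n`. -/
def wavg (u : Fin n → ℝ) (x : Fin n → E) : E := (1 / (n : ℝ)) • ∑ i, u i • x i

/-- The deviation of a stack from its weighted average. -/
def dev (u : Fin n → ℝ) (x : Fin n → E) : Fin n → E := fun i => x i - wavg u x

lemma wavg_sub_smul (u : Fin n → ℝ) (α : ℝ) (x y : Fin n → E) :
    wavg u (x - α • y) = wavg u x - α • wavg u y := by
  simp only [wavg, Pi.sub_apply, Pi.smul_apply, smul_sub, Finset.sum_sub_distrib, Finset.smul_sum,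
    smul_comm α]

lemma wavg_act (hu : IsLeftPerron A u) (x : Fin n → E) : wavg u (act A x) = wavg u x := by
  simp only [wavg, act_apply, Finset.smul_sum]
  rw [Finset.sum_comm]
  refine Finset.sum_congr rfl fun j _ => ?_
  have : u j = ∑ i, u i * A i j := by
    conv_lhs => rw [← hu.eigen]
    rfl
  simp only [smul_smul]
  rw [← Finset.sum_smul, this, Finset.mul_sum]

lemma wavg_const (hu : IsLeftPerron A u) (hn : 0 < n) (x : E) : wavg u (fun _ => x) = x := by
  have hn' : (n : ℝ) ≠ 0 := by positivity
  rw [wavg, ← Finset.sum_smul, hu.mass, smul_smul, one_div_mul_cancel hn', one_smul]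

lemma wavg_sub (u : Fin n → ℝ) (x y : Fin n → E) : wavg u (x - y) = wavg u x - wavg u y := by
  simpa using wavg_sub_smul u 1 x y

lemma wavg_dev (hu : IsLeftPerron A u) (hn : 0 < n) (x : Fin n → E) : wavg u (dev u x) = 0 := by
  have : dev u x = x - fun _ => wavg u x := rfl
  rw [this, wavg_sub, wavg_const hu hn, sub_self]

lemma act_sub_matrix (M N : Matrix (Fin n) (Fin n) ℝ) (x : Fin n → E) :
    act (M - N) x = act M x - act N x := by
  ext i
  simp [act_apply, sub_smul]

lemma act_spread_transpose (u : Fin n → ℝ) (x : Fin n → E) :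
    act (spread u).transpose x = fun _ => wavg u x := by
  ext i
  simp only [act_apply, spread, Matrix.transpose_apply, Matrix.of_apply, wavg, Finset.smul_sum,
    smul_smul]
  exact Finset.sum_congr rfl fun j _ => by congr 1; ring

lemma dev_eq_act (u : Fin n → ℝ) (x : Fin n → E) :
    dev u x = act (1 - (spread u).transpose) x := by
  rw [act_sub_matrix, act_one, act_spread_transpose]
  rfl

lemma act_spread (v : Fin n → ℝ) {w : Fin n → E} (hw : ∑ i, w i = 0) : act (spread v) w = 0 := by
  ext i
  simp [act_apply, spread, ← Finset.smul_sum, hw]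

lemma act_const (hA : ∀ i, ∑ j, A i j = 1) (x : E) : act A (fun _ => x) = fun _ => x := by
  ext i
  rw [act_apply, ← Finset.sum_smul, hA, one_smul]

lemma dev_step (hA : ∀ i, ∑ j, A i j = 1) (hu : IsLeftPerron A u) (hn : 0 < n) (α : ℝ)
    (x y : Fin n → E) :
    dev u (act A x - α • y) = act (A - (spread u).transpose) (dev u x) + (-α) • dev u y := by
  rw [act_sub_matrix, act_spread_transpose, wavg_dev hu hn]
  have : dev u x = x - fun _ => wavg u x := rfl
  rw [this, map_sub, act_const hA]
  ext i
  simp only [dev, wavg_sub_smul, wavg_act hu, Pi.sub_apply, Pi.add_apply, Pi.smul_apply]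
  module

/-- On zero-sum stacks `v1ᵀ/n` vanishes, so `B` may be replaced by the contracting matrix `B -
v1ᵀ/n`. -/
lemma residual_step (v : Fin n → ℝ) {w : Fin n → E} (hw : ∑ i, w i = 0) (G : Fin n → E) :
    act B (w + G) - G = act (B - spread v) w + (act B G - G) := by
  rw [act_sub_matrix, act_spread v hw, map_add]
  abel

lemma sum_act (hB : ∀ j, ∑ i, B i j = 1) (y : Fin n → E) : ∑ i, act B y i = ∑ i, y i := by
  simp only [act_apply]
  rw [Finset.sum_comm]
  simp [← Finset.sum_smul, hB]

lemma sum_residual_step (hB : ∀ j, ∑ i, B i j = 1) {w : Fin n → E} (hw : ∑ i, w i = 0)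
    (G : Fin n → E) : ∑ i, (act B (w + G) - G) i = 0 := by
  simp only [Pi.sub_apply, Finset.sum_sub_distrib, sum_act hB, Pi.add_apply,
    Finset.sum_add_distrib, hw]
  abel

/-- With the correction `h`, the tracking error enters the average only through a telescoping
term. -/
lemma corrected_avg_step {h : Fin n → ℝ} {p : ℝ} (hu : IsLeftPerron A u) (hn : 0 < n)
    (hh : ∀ j, ∑ i, h i * B i j = h j - u j + p / n) (α α' : ℝ) (x : Fin n → E)
    {w : Fin n → E} (hw : ∑ i, w i = 0) (G : Fin n → E) :
    wavg u (act A x - α • (w + G)) - (α' / n) • ∑ i, h i • (act B (w + G) - G) i =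
      wavg u x - (α / n) • ∑ i, h i • w i - (α * (p / n ^ 2)) • ∑ i, G i +
        ((α - α') / n) • ∑ i, h i • (act B (w + G) - G) i := by
  have hn' : (n : ℝ) ≠ 0 := by positivity
  -- This is `h·w' = h·w - u·(w + G) + (p/n) ∑ G`: the equation for `h` trades `u·(w + G)` for a
  -- difference of consecutive values of `h·w` plus the true gradient sum.
  have q : ∑ i, h i • (act B (w + G) - G) i =
      ∑ i, h i • w i - ∑ i, u i • (w + G) i + (p / n) • ∑ i, G i := by
    have e1 : ∑ i, h i • act B (w + G) i = ∑ j, (h j - u j + p / n) • (w + G) j := by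
      simp only [act_apply, Finset.smul_sum, smul_smul]
      rw [Finset.sum_comm]
      exact Finset.sum_congr rfl fun j _ => by rw [← Finset.sum_smul, hh]
    simp only [Pi.sub_apply, smul_sub, Finset.sum_sub_distrib, e1]
    simp only [add_smul, sub_smul, Finset.sum_add_distrib, Finset.sum_sub_distrib,
      ← Finset.smul_sum, Pi.add_apply, smul_add, hw]
    module
  have e2 : ∑ i, u i • (w + G) i =
      ∑ i, h i • w i + (p / n) • ∑ i, G i - ∑ i, h i • (act B (w + G) - G) i := by
    rw [q]; abel
  rw [wavg_sub_smul, wavg_act hu,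
    show wavg u (w + G) = (1 / (n : ℝ)) • ∑ i, u i • (w + G) i from rfl, e2]
  match_scalars <;> field_simp

end Identities

/-! ### Scalar inequalities behind the Lyapunov function -/

section Scalars

/-- Convexity of the square, with `b = ρ (b/ρ)`; it turns a contraction of norms into one of squares
with the same rate. -/
lemma mul_add_sq_le {ρ a b : ℝ} (hρ : 0 < ρ) (hρ1 : ρ ≤ 1) :
    ((1 - ρ) * a + b) ^ 2 ≤ (1 - ρ) * a ^ 2 + 1 / ρ * b ^ 2 := by
  have : (1 - ρ) * a ^ 2 + 1 / ρ * b ^ 2 - ((1 - ρ) * a + b) ^ 2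
      = (1 - ρ) * (ρ * a - b) ^ 2 / ρ := by field_simp; ring
  have : 0 ≤ (1 - ρ) * (ρ * a - b) ^ 2 / ρ := by
    have : 0 ≤ 1 - ρ := by linarith
    positivity
  linarith

/-- The residual is only bounded, not small, but it enters the other errors with a factor `α ^ 2`;
hence its weight `K α ^ 2`. The surplus `m α / 2` in the decay of `e` and the fixed rates `ρ` absorb
every coupling. -/
lemma lyapunov_combination {m ρ C : ℝ} (hm : 0 < m) (hρ : 0 < ρ) (hC : 0 < C) :
    ∃ K α₀ : ℝ, 0 < K ∧ 0 < α₀ ∧ α₀ ≤ 1 ∧ ∀ α α' e c w e' c' w' ν T : ℝ,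
      0 < α → α ≤ α₀ → 0 ≤ α' → α' ≤ α → 0 ≤ e → 0 ≤ c → 0 ≤ w → 0 ≤ w' → 0 ≤ ν →
      e' ≤ (1 - 3 / 2 * m * α + C * α ^ 2) * e + C * α * c + C * α ^ 2 * w
        + C * α ^ 2 * (1 + ν) + T →
      c' ≤ (1 - ρ) * c + C * α ^ 2 * (w + (1 + ν) + c + e) →
      w' ≤ (1 - ρ) * w + C * ((1 + ν) + c + e + α ^ 2 * w) →
      e' + c' + K * α' ^ 2 * w' ≤
        (1 - m * α) * (e + c + K * α ^ 2 * w) + (2 * C + K * C) * α ^ 2 * (1 + ν) + T := by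
  -- The contraction of `w` supplies `K ρ = 6C`: `2C` pays for `w` in the first two inequalities,
  -- and at most `3C` for the higher-order terms.
  set K := 6 * C / ρ with hK
  have hK0 : 0 < K := by positivity
  have hKρ : K * ρ = 6 * C := by rw [hK]; field_simp
  -- After `1`, the three thresholds absorb the excess coefficients of `e`, `c` and `w`, in this
  -- order (`k2`, `k3`, `k4`).
  refine ⟨K, min 1 (min (m / (2 * (2 * C + K * C))) (min (ρ / (2 * C + K * C + m))
    (3 * C / (K * C + K * m)))), hK0, by positivity, min_le_left _ _, ?_⟩
  intro α α' e c w e' c' w' ν T hα hα0 hα'0 hα' he hc hw hw' hν h1 h2 h3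
  obtain ⟨b1, b2⟩ := le_min_iff.1 hα0
  obtain ⟨b2, b3⟩ := le_min_iff.1 b2
  obtain ⟨b3, b4⟩ := le_min_iff.1 b3
  rw [le_div_iff₀ (by positivity)] at b2 b3 b4
  have sq : α ^ 2 ≤ α := by nlinarith
  have k1 : K * α' ^ 2 * w' ≤ K * α ^ 2 * ((1 - ρ) * w + C * ((1 + ν) + c + e + α ^ 2 * w)) := by
    gcongr
  have k2 : (2 * C + K * C) * α ^ 2 * e ≤ 1 / 2 * m * α * e := by
    have : (2 * C + K * C) * α ^ 2 ≤ 1 / 2 * m * α := by nlinarith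
    gcongr
  have k3 : (C * α + C * α ^ 2 + K * C * α ^ 2 + m * α) * c ≤ ρ * c := by
    have : K * C * α ^ 2 ≤ K * C * α := by gcongr
    have : C * α ^ 2 ≤ C * α := by gcongr
    gcongr
    nlinarith
  have k4 : α ^ 2 * ((2 * C + K * C * α ^ 2 + K * m * α) * w) ≤ α ^ 2 * ((K * ρ) * w) := by
    have : K * C * α ^ 2 ≤ K * C * α := by gcongr
    gcongr
    rw [hKρ]
    nlinarith
  nlinarith

end Scalars

/-! ### One-step bounds for each error component -/

section StepBounds

variable {n : ℕ} {E : Type*} [NormedAddCommGroup E]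

lemma norm_sum_sq_le (z : Fin n → E) : ‖∑ i, z i‖ ^ 2 ≤ n * ∑ i, ‖z i‖ ^ 2 := by
  have h1 := pow_le_pow_left₀ (norm_nonneg _) (norm_sum_le Finset.univ z) 2
  have h2 := sq_sum_le_card_mul_sum_sq (s := Finset.univ) (f := fun i => ‖z i‖)
  rw [Finset.card_univ, Fintype.card_fin] at h2
  exact h1.trans h2

section Normed

variable [NormedSpace ℝ E] {A B : Matrix (Fin n) (Fin n) ℝ} {u v : Fin n → ℝ}

lemma norm_sum_smul_le (h : Fin n → ℝ) (w : Fin n → E) :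
    ‖∑ i, h i • w i‖ ≤ (∑ i, |h i|) * ‖w‖ := by
  rw [Finset.sum_mul]
  refine (norm_sum_le _ _).trans (Finset.sum_le_sum fun i _ => ?_)
  rw [norm_smul, Real.norm_eq_abs]
  gcongr
  exact norm_le_pi_norm w i

lemma exists_norm_dev_le (u : Fin n → ℝ) :
    ∃ c, 0 ≤ c ∧ ∀ x : Fin n → E, ‖dev u x‖ ≤ c * ‖x‖ := by
  obtain ⟨c, hc0, hc⟩ := exists_norm_act_le (E := E) (1 - (spread u).transpose)
  refine ⟨c, hc0, fun x => ?_⟩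
  rw [dev_eq_act]
  exact hc x

lemma exists_dev_step_le (hA : ∀ i, ∑ j, A i j = 1) (hu : IsLeftPerron A u) (hn : 0 < n)
    {N : (Fin n → E) → ℝ} {ρ C : ℝ}
    (hN : IsContractingNorm (A - (spread u).transpose) N ρ C) :
    ∃ K, 0 < K ∧ ∀ (α : ℝ) (x y : Fin n → E),
      N (dev u (act A x - α • y)) ^ 2 ≤ (1 - ρ) * N (dev u x) ^ 2 + K * α ^ 2 * ‖y‖ ^ 2 := by
  obtain ⟨c, hc0, hc⟩ := exists_norm_dev_le (E := E) u
  refine ⟨1 / ρ * (C * c) ^ 2 + 1, by have := hN.rate_pos; positivity, fun α x y => ?_⟩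
  rw [dev_step hA hu hn]
  have h1 := hN.contract (dev u x) ((-α) • dev u y)
  have h2 : C * ‖(-α) • dev u y‖ ≤ C * (|α| * (c * ‖y‖)) := by
    rw [norm_smul, Real.norm_eq_abs, abs_neg]
    have := hN.const_pos
    gcongr
    exact hc y
  have h3 := mul_add_sq_le (a := N (dev u x)) (b := C * (|α| * (c * ‖y‖))) hN.rate_pos hN.rate_le
  have h4 : N (act (A - (spread u).transpose) (dev u x) + (-α) • dev u y) ^ 2 ≤
      ((1 - ρ) * N (dev u x) + C * (|α| * (c * ‖y‖))) ^ 2 :=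
    pow_le_pow_left₀ ((norm_nonneg _).trans (hN.lower _)) (by linarith) 2
  have h5 : 1 / ρ * (C * (|α| * (c * ‖y‖))) ^ 2 = 1 / ρ * (C * c) ^ 2 * α ^ 2 * ‖y‖ ^ 2 := by
    rw [mul_pow, mul_pow, mul_pow, sq_abs]; ring
  have h6 : 0 ≤ α ^ 2 * ‖y‖ ^ 2 := by positivity
  linarith

lemma exists_residual_step_le {N : (Fin n → E) → ℝ} {ρ C : ℝ}
    (hN : IsContractingNorm (B - spread v) N ρ C) :
    ∃ K, 0 < K ∧ ∀ w G : Fin n → E, ∑ i, w i = 0 →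
      N (act B (w + G) - G) ^ 2 ≤ (1 - ρ) * N w ^ 2 + K * ‖G‖ ^ 2 := by
  obtain ⟨c, hc0, hc⟩ := exists_norm_act_le (E := E) (B - 1)
  refine ⟨1 / ρ * (C * c) ^ 2 + 1, by have := hN.rate_pos; positivity, fun w G hw => ?_⟩
  rw [residual_step v hw]
  have h1 := hN.contract w (act B G - G)
  have h2 : C * ‖act B G - G‖ ≤ C * (c * ‖G‖) := by
    have := hN.const_pos
    have e := hc G
    rw [act_sub_matrix, act_one] at e
    gcongr
  have h3 := mul_add_sq_le (a := N w) (b := C * (c * ‖G‖)) hN.rate_pos hN.rate_le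
  have h4 : N (act (B - spread v) w + (act B G - G)) ^ 2 ≤
      ((1 - ρ) * N w + C * (c * ‖G‖)) ^ 2 :=
    pow_le_pow_left₀ ((norm_nonneg _).trans (hN.lower _)) (by linarith) 2
  have h5 : 1 / ρ * (C * (c * ‖G‖)) ^ 2 = 1 / ρ * (C * c) ^ 2 * ‖G‖ ^ 2 := by ring
  have h6 : 0 ≤ ‖G‖ ^ 2 := by positivity
  linarith

/-- The error of the corrected average. -/
def err (u h : Fin n → ℝ) (xstar : E) (α : ℝ) (x w : Fin n → E) : E :=
  wavg u x - (α / n) • (∑ i, h i • w i) - xstar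

lemma norm_sub_le_err (hn : 0 < n) (u h : Fin n → ℝ) (xstar : E) {α : ℝ} (hα : 0 ≤ α)
    (x w : Fin n → E) (i : Fin n) :
    ‖x i - xstar‖ ≤ ‖dev u x‖ + ‖err u h xstar α x w‖ + α * ((∑ i, |h i|) * ‖w‖) := by
  have hn1 : (1 : ℝ) ≤ n := by exact_mod_cast hn
  have e : x i - xstar = dev u x i + err u h xstar α x w + (α / n) • ∑ i, h i • w i := by
    simp only [dev, err]; abel
  have h1 : ‖(α / n) • ∑ i, h i • w i‖ ≤ α * ((∑ i, |h i|) * ‖w‖) := by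
    rw [norm_smul, Real.norm_of_nonneg (by positivity)]
    have := norm_sum_smul_le h w
    have : α / n ≤ α := div_le_self hα hn1
    gcongr
  rw [e]
  have := norm_le_pi_norm (dev u x) i
  linarith [norm_add₃_le (a := dev u x i) (b := err u h xstar α x w)
    (c := (α / n) • ∑ i, h i • w i)]

lemma add_three_sq_le (a b c : ℝ) : (a + b + c) ^ 2 ≤ 3 * (a ^ 2 + b ^ 2 + c ^ 2) := by
  nlinarith [sq_nonneg (a - b), sq_nonneg (a - c), sq_nonneg (b - c)]

/-- Each sampled gradient is its noise, plus `F i xstar`, plus a Lipschitz increment controlled by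
the distance of agent `i` to `xstar`. -/
lemma exists_grad_sq_le (hn : 0 < n) (u h : Fin n → ℝ) {F : Fin n → E → E} {L : ℝ}
    (hF : ∀ i x y, ‖F i x - F i y‖ ≤ L * ‖x - y‖) (xstar : E) :
    ∃ C, 0 < C ∧ ∀ α : ℝ, 0 ≤ α → ∀ x w G : Fin n → E,
      ‖G‖ ^ 2 ≤ C * (1 + ∑ i, ‖G i - F i (x i)‖ ^ 2 + ‖dev u x‖ ^ 2 + ‖err u h xstar α x w‖ ^ 2
        + α ^ 2 * ‖w‖ ^ 2) := by
  set b := ∑ i, ‖F i xstar‖ with hb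
  set H := ∑ i, |h i| with hH
  have hb0 : 0 ≤ b := by positivity
  have hH0 : 0 ≤ H := by positivity
  set C := 3 * (1 + b ^ 2 + 3 * L ^ 2 * (1 + H ^ 2)) with hC
  have hC0 : 0 < C := by positivity
  refine ⟨C, hC0, fun α hα x w G => ?_⟩
  set X := 1 + ∑ i, ‖G i - F i (x i)‖ ^ 2 + ‖dev u x‖ ^ 2 + ‖err u h xstar α x w‖ ^ 2
        + α ^ 2 * ‖w‖ ^ 2 with hX
  have hX0 : 0 ≤ X := by positivity
  have pt : ∀ i, ‖G i‖ ^ 2 ≤ C * X := by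
    intro i
    have h1 : ‖G i‖ ≤ ‖G i - F i (x i)‖ + b + L * ‖x i - xstar‖ := by
      have e : G i = (G i - F i (x i)) + F i xstar + (F i (x i) - F i xstar) := by abel
      have h2 : ‖F i xstar‖ ≤ b := Finset.single_le_sum (f := fun i => ‖F i xstar‖)
        (fun _ _ => norm_nonneg _) (Finset.mem_univ i)
      have h3 := norm_add₃_le (a := G i - F i (x i)) (b := F i xstar)
        (c := F i (x i) - F i xstar)
      rw [← e] at h3
      linarith [hF i (x i) xstar]
    have h2 := norm_sub_le_err hn u h xstar hα x w i
    have h3 : ‖x i - xstar‖ ^ 2 ≤ 3 * (‖dev u x‖ ^ 2 + ‖err u h xstar α x w‖ ^ 2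
        + (α * (H * ‖w‖)) ^ 2) :=
      (pow_le_pow_left₀ (norm_nonneg _) h2 2).trans (add_three_sq_le _ _ _)
    have h4 : ‖G i - F i (x i)‖ ^ 2 ≤ ∑ i, ‖G i - F i (x i)‖ ^ 2 :=
      Finset.single_le_sum (f := fun i => ‖G i - F i (x i)‖ ^ 2)
        (fun _ _ => by positivity) (Finset.mem_univ i)
    have h5 := (pow_le_pow_left₀ (norm_nonneg _) h1 2).trans (add_three_sq_le _ _ _)
    have hν : 0 ≤ ∑ i, ‖G i - F i (x i)‖ ^ 2 := by positivity
    have i1 : ‖G i - F i (x i)‖ ^ 2 ≤ X := by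
      have : 0 ≤ ‖dev u x‖ ^ 2 + ‖err u h xstar α x w‖ ^ 2 + α ^ 2 * ‖w‖ ^ 2 := by positivity
      linarith
    have i2 : b ^ 2 ≤ b ^ 2 * X := by
      have : 1 ≤ X := by
        have : 0 ≤ ‖dev u x‖ ^ 2 + ‖err u h xstar α x w‖ ^ 2 + α ^ 2 * ‖w‖ ^ 2 := by positivity
        linarith
      exact le_mul_of_one_le_right (by positivity) this
    have i3 : ‖x i - xstar‖ ^ 2 ≤ 3 * ((1 + H ^ 2) * X) := by
      refine h3.trans ?_
      have j1 : (α * (H * ‖w‖)) ^ 2 ≤ H ^ 2 * X := by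
        have : (α * (H * ‖w‖)) ^ 2 = H ^ 2 * (α ^ 2 * ‖w‖ ^ 2) := by ring
        rw [this]
        gcongr
        have : 0 ≤ ‖dev u x‖ ^ 2 + ‖err u h xstar α x w‖ ^ 2 := by positivity
        linarith
      have j2 : ‖dev u x‖ ^ 2 + ‖err u h xstar α x w‖ ^ 2 ≤ X := by
        have : 0 ≤ α ^ 2 * ‖w‖ ^ 2 := by positivity
        linarith
      linarith
    have i4 : (L * ‖x i - xstar‖) ^ 2 ≤ L ^ 2 * (3 * ((1 + H ^ 2) * X)) := by
      rw [mul_pow]; gcongr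
    calc ‖G i‖ ^ 2 ≤ _ := h5
      _ ≤ 3 * (X + b ^ 2 * X + L ^ 2 * (3 * ((1 + H ^ 2) * X))) := by linarith
      _ = C * X := by rw [hC]; ring
  have : ‖G‖ ≤ √(C * X) :=
    (pi_norm_le_iff_of_nonneg (Real.sqrt_nonneg _)).2 fun i => Real.le_sqrt_of_sq_le (pt i)
  calc ‖G‖ ^ 2 ≤ √(C * X) ^ 2 := by gcongr
    _ = C * X := Real.sq_sqrt (by positivity)

end Normed

section Inner

variable [InnerProductSpace ℝ E]

/-- Strong monotonicity gives a decay of `2 τ μ`; a Young inequality spends `τ μ / 2` of it on the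
gradient mismatch `R`. -/
lemma norm_sq_descent_le {μ τ L : ℝ} (hμ : 0 < μ) (hτ : 0 ≤ τ) {e Φ : E} (R : E)
    (hmono : μ * ‖e‖ ^ 2 ≤ inner ℝ Φ e) (hΦ : ‖Φ‖ ≤ L * ‖e‖) :
    ‖e - τ • (Φ + R)‖ ^ 2 ≤ (1 - 3 / 2 * (τ * μ)) * ‖e‖ ^ 2 + 2 * τ / μ * ‖R‖ ^ 2
      + τ ^ 2 * (2 * L ^ 2 * ‖e‖ ^ 2 + 2 * ‖R‖ ^ 2) := by
  have h1 : ‖e - τ • (Φ + R)‖ ^ 2 =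
      ‖e‖ ^ 2 - 2 * τ * (inner ℝ Φ e + inner ℝ R e) + τ ^ 2 * ‖Φ + R‖ ^ 2 := by
    rw [norm_sub_sq_real, inner_smul_right, norm_smul, mul_pow, Real.norm_eq_abs, sq_abs,
      real_inner_comm, inner_add_left]
    ring
  have h2 : -inner ℝ R e ≤ ‖R‖ * ‖e‖ := by
    have := abs_real_inner_le_norm R e
    linarith [neg_abs_le (inner ℝ R e : ℝ)]
  have h3 : ‖R‖ * ‖e‖ ≤ 1 / μ * ‖R‖ ^ 2 + μ / 4 * ‖e‖ ^ 2 := by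
    have : 1 / μ * ‖R‖ ^ 2 + μ / 4 * ‖e‖ ^ 2 - ‖R‖ * ‖e‖ = (‖R‖ - μ / 2 * ‖e‖) ^ 2 / μ := by
      field_simp; ring
    have : 0 ≤ (‖R‖ - μ / 2 * ‖e‖) ^ 2 / μ := by positivity
    linarith
  have h4 : ‖Φ + R‖ ^ 2 ≤ 2 * L ^ 2 * ‖e‖ ^ 2 + 2 * ‖R‖ ^ 2 := by
    have a := pow_le_pow_left₀ (norm_nonneg _) (norm_add_le Φ R) 2
    have b := pow_le_pow_left₀ (norm_nonneg _) hΦ 2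
    nlinarith [sq_nonneg (‖Φ‖ - ‖R‖)]
  rw [h1]
  have h5 : τ * (-(inner ℝ Φ e + inner ℝ R e)) ≤
      τ * (1 / μ * ‖R‖ ^ 2 + μ / 4 * ‖e‖ ^ 2 - μ * ‖e‖ ^ 2) := by
    gcongr; linarith
  have h6 : τ ^ 2 * ‖Φ + R‖ ^ 2 ≤ τ ^ 2 * (2 * L ^ 2 * ‖e‖ ^ 2 + 2 * ‖R‖ ^ 2) := by gcongr
  have h7 : 2 * τ / μ * ‖R‖ ^ 2 = 2 * (τ * (1 / μ * ‖R‖ ^ 2)) := by ring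
  rw [h7]
  linarith

/-- The product of `a` with the noise `N` is kept exact, because its mean will vanish. The vector
`q` will contain the same fresh noise, so its product is only bounded; this is affordable because
`γ` will be `O(α²)`. -/
lemma norm_sq_perturbed_le {γ τ : ℝ} (hγ : 0 ≤ γ) (a N q : E) :
    ‖a - τ • N + γ • q‖ ^ 2 ≤ ‖a‖ ^ 2 - 2 * τ * inner ℝ a N + τ ^ 2 * ‖N‖ ^ 2
      + γ * (2 * ‖a‖ ^ 2 + 2 * (τ ^ 2 * ‖N‖ ^ 2) + ‖q‖ ^ 2) + γ ^ 2 * ‖q‖ ^ 2 := by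
  have h1 : ‖a - τ • N‖ ^ 2 = ‖a‖ ^ 2 - 2 * τ * inner ℝ a N + τ ^ 2 * ‖N‖ ^ 2 := by
    rw [norm_sub_sq_real, inner_smul_right, norm_smul, mul_pow, Real.norm_eq_abs, sq_abs]
    ring
  have h2 : ‖a - τ • N + γ • q‖ ^ 2 =
      ‖a - τ • N‖ ^ 2 + 2 * γ * inner ℝ (a - τ • N) q + γ ^ 2 * ‖q‖ ^ 2 := by
    rw [norm_add_sq_real, inner_smul_right, norm_smul, mul_pow, Real.norm_eq_abs, sq_abs]
    ring
  have h3 : 2 * inner ℝ (a - τ • N) q ≤ ‖a - τ • N‖ ^ 2 + ‖q‖ ^ 2 := by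
    nlinarith [real_inner_le_norm (a - τ • N) q, sq_nonneg (‖a - τ • N‖ - ‖q‖)]
  have h4 : ‖a - τ • N‖ ^ 2 ≤ 2 * ‖a‖ ^ 2 + 2 * (τ ^ 2 * ‖N‖ ^ 2) := by
    have a1 := pow_le_pow_left₀ (norm_nonneg _) (norm_sub_le a (τ • N)) 2
    rw [norm_smul] at a1
    have a2 : ‖τ‖ ^ 2 = τ ^ 2 := by rw [Real.norm_eq_abs, sq_abs]
    have a3 : τ ^ 2 * ‖N‖ ^ 2 = (‖τ‖ * ‖N‖) ^ 2 := by rw [mul_pow, a2]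
    rw [a3]
    nlinarith [sq_nonneg (‖a‖ - ‖τ‖ * ‖N‖)]
  have h5 : γ * (2 * inner ℝ (a - τ • N) q) ≤
      γ * (2 * ‖a‖ ^ 2 + 2 * (τ ^ 2 * ‖N‖ ^ 2) + ‖q‖ ^ 2) := by
    gcongr; linarith
  rw [h2, h1]
  linarith

/-- The error recursion, with all higher-order terms collected. -/
lemma exists_err_sq_le {μ β L M κ : ℝ} (hμ : 0 < μ) (hβ : 0 < β) (hM : 0 ≤ M) (hκ : 0 ≤ κ) :
    ∃ C, 0 < C ∧ ∀ (α γ c w ν : ℝ) (e Φ R N q : E), 0 < α → α ≤ 1 → 0 ≤ γ → γ ≤ κ * α ^ 2 →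
      0 ≤ c → 0 ≤ w → 0 ≤ ν → μ * ‖e‖ ^ 2 ≤ inner ℝ Φ e → ‖Φ‖ ≤ L * ‖e‖ →
      ‖R‖ ^ 2 ≤ M * (c + α ^ 2 * w) → ‖N‖ ^ 2 ≤ M * ν →
      ‖e - (α * β) • (Φ + R) - (α * β) • N + γ • q‖ ^ 2 ≤
        (1 - 3 / 2 * (β * μ) * α + C * α ^ 2) * ‖e‖ ^ 2 + C * α * c + C * α ^ 2 * w
          + C * α ^ 2 * ν + C * α ^ 2 * ‖q‖ ^ 2
          - 2 * (α * β) * inner ℝ (e - (α * β) • (Φ + R)) N := by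
  set C₁ := 2 * β ^ 2 * L ^ 2 with hC₁
  set C₂ := (2 * β / μ + 2 * β ^ 2) * M with hC₂
  have h₁ : 0 ≤ C₁ := by positivity
  have h₂ : 0 ≤ C₂ := by positivity
  refine ⟨C₁ + C₂ + 2 * κ * (1 + C₁) + 2 * κ * C₂ + (1 + 2 * κ) * β ^ 2 * M + κ + κ ^ 2 + 1,
    by positivity, ?_⟩
  intro α γ c w ν e Φ R N q hα hα1 hγ hγκ hc hw hν hmono hΦ hR hN
  set a := e - (α * β) • (Φ + R) with ha
  have sq1 : α ^ 2 ≤ 1 := pow_le_one₀ hα.le hα1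
  have sq2 : α ^ 2 ≤ α := by nlinarith
  have hγκ' : γ ≤ κ := hγκ.trans (mul_le_of_le_one_right hκ sq1)
  have d1 := norm_sq_descent_le hμ (by positivity : 0 ≤ α * β) R hmono hΦ
  have d2 := norm_sq_perturbed_le (τ := α * β) hγ a N q
  have d3 : 2 * (α * β) / μ * ‖R‖ ^ 2 + (α * β) ^ 2 * (2 * ‖R‖ ^ 2) ≤
      C₂ * (α * c + α ^ 2 * w) := by
    have r1 : 2 * (α * β) / μ * ‖R‖ ^ 2 + (α * β) ^ 2 * (2 * ‖R‖ ^ 2)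
        = (2 * β / μ * α + 2 * β ^ 2 * α ^ 2) * ‖R‖ ^ 2 := by ring
    have r2 : 2 * β / μ * α + 2 * β ^ 2 * α ^ 2 ≤ (2 * β / μ + 2 * β ^ 2) * α := by
      rw [add_mul]; gcongr
    calc _ = _ := r1
      _ ≤ (2 * β / μ + 2 * β ^ 2) * α * (M * (c + α ^ 2 * w)) := by gcongr
      _ = C₂ * (α * c + α * (α ^ 2 * w)) := by rw [hC₂]; ring
      _ ≤ C₂ * (α * c + 1 * (α ^ 2 * w)) := by gcongr
      _ = _ := by rw [one_mul]
  have d4 : ‖a‖ ^ 2 ≤ (1 - 3 / 2 * (β * μ) * α + C₁ * α ^ 2) * ‖e‖ ^ 2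
      + C₂ * (α * c + α ^ 2 * w) := by
    rw [hC₁]
    linarith
  have d5 : ‖a‖ ^ 2 ≤ (1 + C₁) * ‖e‖ ^ 2 + C₂ * (c + w) := by
    refine d4.trans ?_
    gcongr ?_ * _ + _ * (?_ + ?_)
    · have : 0 ≤ 3 / 2 * (β * μ) * α := by positivity
      have : C₁ * α ^ 2 ≤ C₁ := mul_le_of_le_one_right h₁ sq1
      linarith
    · exact mul_le_of_le_one_left hc hα1
    · exact mul_le_of_le_one_left hw sq1
  have d6 : (α * β) ^ 2 * ‖N‖ ^ 2 ≤ β ^ 2 * M * (α ^ 2 * ν) := by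
    calc (α * β) ^ 2 * ‖N‖ ^ 2 ≤ (α * β) ^ 2 * (M * ν) := by gcongr
      _ = _ := by ring
  have d7 : γ * (2 * ‖a‖ ^ 2) ≤ 2 * κ * (1 + C₁) * (α ^ 2 * ‖e‖ ^ 2)
      + 2 * κ * C₂ * (α * c + α ^ 2 * w) := by
    calc γ * (2 * ‖a‖ ^ 2) ≤ (κ * α ^ 2) * (2 * ((1 + C₁) * ‖e‖ ^ 2 + C₂ * (c + w))) := by
          gcongr
      _ = 2 * κ * (1 + C₁) * (α ^ 2 * ‖e‖ ^ 2) + 2 * κ * C₂ * (α ^ 2 * c + α ^ 2 * w) := by ring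
      _ ≤ _ := by gcongr
  have d8 : γ * (2 * ((α * β) ^ 2 * ‖N‖ ^ 2)) ≤ κ * (2 * (β ^ 2 * M * (α ^ 2 * ν))) := by
    gcongr
  have d9 : γ * ‖q‖ ^ 2 ≤ κ * (α ^ 2 * ‖q‖ ^ 2) := by
    rw [← mul_assoc]; gcongr
  have d10 : γ ^ 2 * ‖q‖ ^ 2 ≤ κ ^ 2 * (α ^ 2 * ‖q‖ ^ 2) := by
    have : γ ^ 2 ≤ κ * (κ * α ^ 2) := by rw [sq]; gcongr
    calc γ ^ 2 * ‖q‖ ^ 2 ≤ κ * (κ * α ^ 2) * ‖q‖ ^ 2 := by gcongr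
      _ = _ := by ring
  have total : ‖a - (α * β) • N + γ • q‖ ^ 2 ≤ (1 - 3 / 2 * (β * μ) * α) * ‖e‖ ^ 2
      + (C₁ + 2 * κ * (1 + C₁)) * (α ^ 2 * ‖e‖ ^ 2) + (C₂ + 2 * κ * C₂) * (α * c)
      + (C₂ + 2 * κ * C₂) * (α ^ 2 * w) + (1 + 2 * κ) * β ^ 2 * M * (α ^ 2 * ν)
      + (κ + κ ^ 2) * (α ^ 2 * ‖q‖ ^ 2) - 2 * (α * β) * inner ℝ a N := by
    linarith
  refine total.trans ?_
  have p1 : 0 ≤ (1 + 2 * κ) * β ^ 2 * M := by positivity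
  have p2 : 0 ≤ 2 * κ * (1 + C₁) := by positivity
  have p3 : 0 ≤ 2 * κ * C₂ := by positivity
  have p4 : 0 ≤ κ ^ 2 := by positivity
  set C := C₁ + C₂ + 2 * κ * (1 + C₁) + 2 * κ * C₂ + (1 + 2 * κ) * β ^ 2 * M + κ + κ ^ 2 + 1
    with hC
  have f1 : (C₁ + 2 * κ * (1 + C₁)) * (α ^ 2 * ‖e‖ ^ 2) ≤ C * (α ^ 2 * ‖e‖ ^ 2) := by
    gcongr; linarith
  have f2 : (C₂ + 2 * κ * C₂) * (α * c) ≤ C * (α * c) := by gcongr; linarith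
  have f3 : (C₂ + 2 * κ * C₂) * (α ^ 2 * w) ≤ C * (α ^ 2 * w) := by gcongr; linarith
  have f4 : (1 + 2 * κ) * β ^ 2 * M * (α ^ 2 * ν) ≤ C * (α ^ 2 * ν) := by gcongr; linarith
  have f5 : (κ + κ ^ 2) * (α ^ 2 * ‖q‖ ^ 2) ≤ C * (α ^ 2 * ‖q‖ ^ 2) := by gcongr; linarith
  linarith

end Inner

end StepBounds

/-! ### Lyapunov decrease along one step -/

section Lyapunov

variable {n : ℕ} {E : Type*} [NormedAddCommGroup E] [InnerProductSpace ℝ E]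

/-- The Lyapunov function of the method. -/
def lyapunov (u h : Fin n → ℝ) (xstar : E) (NA NB : (Fin n → E) → ℝ) (K α : ℝ)
    (x w : Fin n → E) : ℝ :=
  ‖err u h xstar α x w‖ ^ 2 + NA (dev u x) ^ 2 + K * α ^ 2 * NB w ^ 2

set_option maxHeartbeats 1000000 in
/-- One step of the method decreases the Lyapunov function, up to the noise. -/
theorem exists_lyapunov_step {A B : Matrix (Fin n) (Fin n) ℝ} (hAB : WeightAssumption A B)
    {u v h : Fin n → ℝ} (hu : IsLeftPerron A u) {p : ℝ} (hp : 0 < p)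
    (hh : ∀ j, ∑ i, h i * B i j = h j - u j + p / n)
    {NA NB : (Fin n → E) → ℝ} {ρA ρB CA CB : ℝ}
    (hNA : IsContractingNorm (A - (spread u).transpose) NA ρA CA)
    (hNB : IsContractingNorm (B - spread v) NB ρB CB)
    {F : Fin n → E → E} {L : ℝ} (hL : 0 ≤ L)
    (hF : ∀ i x y, ‖F i x - F i y‖ ≤ L * ‖x - y‖) {xstar : E} (hstat : ∑ i, F i xstar = 0)
    {μ : ℝ} (hμ : 0 < μ)
    (hmono : ∀ x, μ * ‖x - xstar‖ ^ 2 ≤ inner ℝ (∑ i, F i x) (x - xstar))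
    {κ : ℝ} (hκ : 0 ≤ κ) :
    ∃ K C α₀ : ℝ, 0 < K ∧ 0 < C ∧ 0 < α₀ ∧ ∀ α α' : ℝ, 0 < α → α ≤ α₀ → 0 ≤ α' → α' ≤ α →
      α - α' ≤ κ * α ^ 2 → ∀ x w G : Fin n → E, ∑ i, w i = 0 →
      lyapunov u h xstar NA NB K α' (act A x - α • (w + G)) (act B (w + G) - G) ≤
        (1 - p / n ^ 2 * μ * α) * lyapunov u h xstar NA NB K α x w
          + C * α ^ 2 * (1 + ∑ i, ‖G i - F i (x i)‖ ^ 2)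
          - 2 * (α * (p / n ^ 2)) * inner ℝ (err u h xstar α x w
              - (α * (p / n ^ 2)) • ∑ i, F i (x i)) (∑ i, (G i - F i (x i))) := by
  have hn := hAB.pos
  have hn1 : (1 : ℝ) ≤ n := by exact_mod_cast hn
  have hn0 : (0 : ℝ) < n := by linarith
  set H := ∑ i, |h i| with hH
  have hH0 : 0 ≤ H := by positivity
  obtain ⟨C₁, hC₁, bG⟩ := exists_grad_sq_le hn u h hF xstar
  obtain ⟨C₂, hC₂, bD⟩ := exists_dev_step_le hAB.A_row hu hn hNA
  obtain ⟨C₃, hC₃, bW⟩ := exists_residual_step_le hNB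
  -- The summand `n` is the Cauchy–Schwarz factor in `Nle`; the other summand bounds the gradient
  -- mismatch in `Rle`.
  set M := n + 2 * (n * L) ^ 2 * (1 + H ^ 2) with hM
  have hM0 : 0 ≤ M := by positivity
  obtain ⟨C₀, hC₀, bE⟩ := exists_err_sq_le (E := E) (L := n * L) hμ
    (show 0 < p / (n : ℝ) ^ 2 by positivity) hM0 hκ
  set Q := H ^ 2 * (1 + C₃ * C₁) with hQ
  have hQ0 : 0 ≤ Q := by positivity
  set C := C₀ * (1 + Q) + 2 * C₂ * (1 + C₁) + C₃ * C₁ with hC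
  have hC0 : 0 < C := by positivity
  have hρA := hNA.rate_pos
  have hρB := hNB.rate_pos
  obtain ⟨K, α₀, hK, hα₀, hα₀1, comb⟩ := lyapunov_combination (m := p / n ^ 2 * μ)
    (ρ := min ρA ρB) (by positivity) (by positivity) hC0
  refine ⟨K, 2 * C + K * C, α₀, hK, by positivity, hα₀, ?_⟩
  intro α α' hα hαα₀ hα'0 hα' hdiff x w G hw
  have hα1 := hαα₀.trans hα₀1
  have sq1 : α ^ 2 ≤ 1 := pow_le_one₀ hα.le hα1
  have sq2 : α ^ 2 ≤ α := by nlinarith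
  set x' := act A x - α • (w + G) with hx'
  set w' := act B (w + G) - G with hw'
  set e := err u h xstar α x w with he
  set ν := ∑ i, ‖G i - F i (x i)‖ ^ 2 with hν
  set N := ∑ i, (G i - F i (x i)) with hN
  set c := NA (dev u x) ^ 2 with hc
  set b := NB w ^ 2 with hb
  have hν0 : 0 ≤ ν := by positivity
  have hc0 : 0 ≤ c := by positivity
  have hb0 : 0 ≤ b := by positivity
  have dc : ‖dev u x‖ ^ 2 ≤ c := pow_le_pow_left₀ (norm_nonneg _) (hNA.lower _) 2
  have wb : ‖w‖ ^ 2 ≤ b := pow_le_pow_left₀ (norm_nonneg _) (hNB.lower _) 2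
  have gb : ‖G‖ ^ 2 ≤ C₁ * ((1 + ν) + c + ‖e‖ ^ 2 + α ^ 2 * b) := by
    refine (bG α hα.le x w G).trans ?_
    gcongr
  set S := b + (1 + ν) + c + ‖e‖ ^ 2 with hS
  have hS0 : 0 ≤ S := by positivity
  have gS : ‖G‖ ^ 2 ≤ C₁ * S := by
    refine gb.trans ?_
    have : α ^ 2 * b ≤ b := mul_le_of_le_one_left hb0 sq1
    gcongr
    linarith
  have bS : b ≤ S := by
    have : 0 ≤ (1 + ν) + c + ‖e‖ ^ 2 := by positivity
    linarith
  -- the residual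
  have w'le : NB w' ^ 2 ≤ (1 - ρB) * b + C₃ * ‖G‖ ^ 2 := bW w G hw
  set q := ∑ i, h i • w' i with hq
  have qle : ‖q‖ ^ 2 ≤ Q * S := by
    have q1 : ‖q‖ ^ 2 ≤ (H * NB w') ^ 2 := by
      refine pow_le_pow_left₀ (norm_nonneg _) ((norm_sum_smul_le h w').trans ?_) 2
      gcongr
      exact hNB.lower _
    have q2 : NB w' ^ 2 ≤ S + C₃ * (C₁ * S) := by
      have g1 : C₃ * ‖G‖ ^ 2 ≤ C₃ * (C₁ * S) := by gcongr
      have g2 : 0 ≤ ρB * b := by positivity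
      linarith only [g1, g2, w'le, bS]
    calc ‖q‖ ^ 2 ≤ H ^ 2 * NB w' ^ 2 := by rw [← mul_pow]; exact q1
      _ ≤ H ^ 2 * (S + C₃ * (C₁ * S)) := by gcongr
      _ = Q * S := by rw [hQ]; ring
  -- the deviation
  have d'le : NA (dev u x') ^ 2 ≤ (1 - ρA) * c + C₂ * α ^ 2 * ‖w + G‖ ^ 2 := bD α x (w + G)
  have yle : ‖w + G‖ ^ 2 ≤ 2 * (1 + C₁) * S := by
    have y1 := pow_le_pow_left₀ (norm_nonneg _) (norm_add_le w G) 2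
    have y2 : (‖w‖ + ‖G‖) ^ 2 ≤ 2 * ‖w‖ ^ 2 + 2 * ‖G‖ ^ 2 := by
      nlinarith only [sq_nonneg (‖w‖ - ‖G‖)]
    linarith only [y1, y2, wb, bS, gS]
  -- the error
  set Φ := ∑ i, F i (xstar + e) with hΦ
  set R := ∑ i, F i (x i) - Φ with hR
  have ΦR : ∑ i, F i (x i) = Φ + R := by rw [hR]; abel
  have e'eq : err u h xstar α' x' w' =
      e - (α * (p / n ^ 2)) • (Φ + R) - (α * (p / n ^ 2)) • N + ((α - α') / n) • q := by
    have := corrected_avg_step hu hn hh α α' x hw G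
    have hG : ∑ i, G i = (Φ + R) + N := by
      rw [← ΦR, hN, Finset.sum_sub_distrib]; abel
    rw [err, this, hG, he, err]
    simp only [smul_add]
    abel
  have monoΦ : μ * ‖e‖ ^ 2 ≤ inner ℝ Φ e := by simpa using hmono (xstar + e)
  have Φle : ‖Φ‖ ≤ n * L * ‖e‖ := by
    have : Φ = ∑ i, (F i (xstar + e) - F i xstar) := by
      rw [Finset.sum_sub_distrib, hstat, sub_zero]
    rw [this]
    refine (norm_sum_le _ _).trans ((Finset.sum_le_sum fun i _ => hF i _ _).trans_eq ?_)
    simp [mul_assoc]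
  have Rle : ‖R‖ ^ 2 ≤ M * (c + α ^ 2 * b) := by
    have r1 : ‖R‖ ≤ n * L * (‖dev u x‖ + α * (H * ‖w‖)) := by
      rw [hR, hΦ, ← Finset.sum_sub_distrib]
      refine (norm_sum_le _ _).trans ((Finset.sum_le_sum (g := fun _ =>
        L * (‖dev u x‖ + α * (H * ‖w‖))) fun i _ => ?_).trans_eq (by simp [mul_assoc]))
      refine (hF i _ _).trans ?_
      gcongr
      have r2 : x i - (xstar + e) = dev u x i + (α / n) • ∑ i, h i • w i := by
        simp only [he, err, dev]; abel
      rw [r2]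
      refine (norm_add_le _ _).trans (add_le_add (norm_le_pi_norm (dev u x) i) ?_)
      rw [norm_smul, Real.norm_of_nonneg (by positivity)]
      have := norm_sum_smul_le h w
      have : α / n ≤ α := div_le_self hα.le hn1
      gcongr
    have r3 : (‖dev u x‖ + α * (H * ‖w‖)) ^ 2 ≤ 2 * (1 + H ^ 2) * (c + α ^ 2 * b) := by
      have s1 : (‖dev u x‖ + α * (H * ‖w‖)) ^ 2 ≤ 2 * (‖dev u x‖ ^ 2 + H ^ 2 * (α ^ 2 * ‖w‖ ^ 2)) := by
        nlinarith only [sq_nonneg (‖dev u x‖ - α * (H * ‖w‖))]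
      have s2 : ‖dev u x‖ ^ 2 + H ^ 2 * (α ^ 2 * ‖w‖ ^ 2) ≤ c + H ^ 2 * (α ^ 2 * b) := by gcongr
      have s3 : 0 ≤ H ^ 2 * c := by positivity
      have s4 : 0 ≤ α ^ 2 * b := by positivity
      linarith only [s1, s2, s3, s4]
    calc ‖R‖ ^ 2 ≤ (n * L * (‖dev u x‖ + α * (H * ‖w‖))) ^ 2 :=
          pow_le_pow_left₀ (norm_nonneg _) r1 2
      _ = (n * L) ^ 2 * (‖dev u x‖ + α * (H * ‖w‖)) ^ 2 := by rw [mul_pow]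
      _ ≤ (n * L) ^ 2 * (2 * (1 + H ^ 2) * (c + α ^ 2 * b)) := by gcongr
      _ = (2 * (n * L) ^ 2 * (1 + H ^ 2)) * (c + α ^ 2 * b) := by ring
      _ ≤ M * (c + α ^ 2 * b) := by gcongr; exact le_add_of_nonneg_left hn0.le
  have Nle : ‖N‖ ^ 2 ≤ M * ν := by
    refine (norm_sum_sq_le _).trans ?_
    have : (n : ℝ) ≤ M := le_add_of_nonneg_right (by positivity)
    gcongr
  have γle : (α - α') / n ≤ κ * α ^ 2 := (div_le_self (by linarith) hn1).trans hdiff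
  have main := bE α ((α - α') / n) c b ν e Φ R N q hα hα1 (div_nonneg (by linarith) hn0.le) γle
    hc0 hb0 hν0 monoΦ Φle Rle Nle
  rw [← e'eq] at main
  rw [lyapunov, lyapunov, ΦR]
  have final := comb α α' (‖e‖ ^ 2) c b (‖err u h xstar α' x' w'‖ ^ 2) (NA (dev u x') ^ 2)
    (NB w' ^ 2) ν (-(2 * (α * (p / n ^ 2)) * inner ℝ (e - (α * (p / n ^ 2)) • (Φ + R)) N))
    hα hαα₀ hα'0 hα' (by positivity) hc0 hb0 (by positivity) hν0 ?_ ?_ ?_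
  · linarith only [final]
  · have t1 : C₀ * α ^ 2 * ‖q‖ ^ 2 ≤ C₀ * Q * (α ^ 2 * S) := by
      calc C₀ * α ^ 2 * ‖q‖ ^ 2 ≤ C₀ * α ^ 2 * (Q * S) := by gcongr
        _ = _ := by ring
    have t2 : C₀ * Q * (α ^ 2 * c) ≤ C₀ * Q * (α * c) := by gcongr
    have hCC : C₀ + C₀ * Q ≤ C := by
      have : 0 ≤ 2 * C₂ * (1 + C₁) + C₃ * C₁ := by positivity
      linarith only [this, hC]
    have t3 : (C₀ + C₀ * Q) * (α ^ 2 * ‖e‖ ^ 2) ≤ C * (α ^ 2 * ‖e‖ ^ 2) := by gcongr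
    have t4 : (C₀ + C₀ * Q) * (α * c) ≤ C * (α * c) := by gcongr
    have t5 : (C₀ + C₀ * Q) * (α ^ 2 * b) ≤ C * (α ^ 2 * b) := by gcongr
    have t6 : (C₀ + C₀ * Q) * (α ^ 2 * (1 + ν)) ≤ C * (α ^ 2 * (1 + ν)) := by gcongr
    have t7 : 0 ≤ C₀ * α ^ 2 := by positivity
    rw [hS] at t1
    linarith only [t1, t2, t3, t4, t5, t6, t7, main]
  · have t1 : C₂ * α ^ 2 * ‖w + G‖ ^ 2 ≤ 2 * C₂ * (1 + C₁) * (α ^ 2 * S) := by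
      calc C₂ * α ^ 2 * ‖w + G‖ ^ 2 ≤ C₂ * α ^ 2 * (2 * (1 + C₁) * S) := by gcongr
        _ = _ := by ring
    have t2 : 2 * C₂ * (1 + C₁) * (α ^ 2 * S) ≤ C * (α ^ 2 * S) := by
      gcongr
      have : 0 ≤ C₀ * (1 + Q) + C₃ * C₁ := by positivity
      linarith only [this, hC]
    have t3 : min ρA ρB * c ≤ ρA * c := by gcongr; exact min_le_left _ _
    linarith only [t1, t2, t3, d'le, hS]
  · have t1 : C₃ * ‖G‖ ^ 2 ≤ C₃ * C₁ * ((1 + ν) + c + ‖e‖ ^ 2 + α ^ 2 * b) := by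
      calc C₃ * ‖G‖ ^ 2 ≤ C₃ * (C₁ * ((1 + ν) + c + ‖e‖ ^ 2 + α ^ 2 * b)) := by gcongr
        _ = _ := by ring
    have t2 : C₃ * C₁ * ((1 + ν) + c + ‖e‖ ^ 2 + α ^ 2 * b) ≤
        C * ((1 + ν) + c + ‖e‖ ^ 2 + α ^ 2 * b) := by
      gcongr
      have : 0 ≤ C₀ * (1 + Q) + 2 * C₂ * (1 + C₁) := by positivity
      linarith only [this, hC]
    have t3 : min ρA ρB * b ≤ ρB * b := by gcongr; exact min_le_right _ _
    linarith only [t1, t2, t3, w'le]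

end Lyapunov

/-! ### The scalar recursion -/

section Sequences

/-- A perturbed contraction `V_{k+1} ≤ (1 - m α_k) V_k + C α_k²` forces `V_k = O(α_k)` when the
steps decrease slowly enough. -/
lemma exists_le_mul_of_recursion {V α : ℕ → ℝ} {m m' C : ℝ} (hm : m' < m) (hC : 0 ≤ C)
    (hα : ∀ k, 0 < α k) {k₀ : ℕ} (hstep : ∀ k, k₀ ≤ k → m * α k ≤ 1)
    (hslow : ∀ k, k₀ ≤ k → α k - α (k + 1) ≤ m' * α k ^ 2)
    (hV : ∀ k, k₀ ≤ k → V (k + 1) ≤ (1 - m * α k) * V k + C * α k ^ 2) :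
    ∃ M, 0 < M ∧ ∀ k, V k ≤ M * α k := by
  -- The first entry starts the induction. The second makes `C ≤ M₀ (m - m')`, so the new bound is
  -- at most `M₀ (α k - m' α k ^ 2) ≤ M₀ α (k + 1)`.
  set M₀ := max (V k₀ / α k₀) (C / (m - m')) with hM₀
  have hmm : 0 < m - m' := by linarith
  have hM₀0 : 0 ≤ M₀ := le_max_of_le_right (by positivity)
  have tail : ∀ k, k₀ ≤ k → V k ≤ M₀ * α k := by
    intro k hk
    induction k, hk using Nat.le_induction with
    | base => exact (div_le_iff₀ (hα k₀)).1 (le_max_left _ _)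
    | succ k hk ih =>
      have h1 : C ≤ M₀ * (m - m') := (div_le_iff₀ hmm).1 (le_max_right _ _)
      have h2 : (1 - m * α k) * V k ≤ (1 - m * α k) * (M₀ * α k) := by
        have := hstep k hk
        gcongr
      have h3 : C * α k ^ 2 ≤ M₀ * (m - m') * α k ^ 2 := by gcongr
      have h4 : M₀ * (α k - α (k + 1)) ≤ M₀ * (m' * α k ^ 2) := by
        have := hslow k hk
        gcongr
      linarith [hV k hk]
  -- The sum covers the finitely many times before `k₀`; the final `1` keeps the constant positive.
  refine ⟨M₀ + ∑ k ∈ Finset.range k₀, |V k| / α k + 1, ?_, fun k => ?_⟩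
  · have : 0 ≤ ∑ k ∈ Finset.range k₀, |V k| / α k :=
      Finset.sum_nonneg fun k _ => div_nonneg (abs_nonneg _) (hα k).le
    linarith
  · have hs : 0 ≤ ∑ k ∈ Finset.range k₀, |V k| / α k :=
      Finset.sum_nonneg fun k _ => div_nonneg (abs_nonneg _) (hα k).le
    have hk := hα k
    rcases le_or_gt k₀ k with h | h
    · refine (tail k h).trans ?_
      gcongr
      linarith
    · have h1 := Finset.single_le_sum (f := fun k => |V k| / α k) (s := Finset.range k₀)
        (fun k _ => div_nonneg (abs_nonneg _) (hα k).le) (Finset.mem_range.2 h)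
      rw [← div_le_iff₀ hk]
      have h2 : V k / α k ≤ |V k| / α k := by gcongr; exact le_abs_self _
      linarith

end Sequences

/-! ### Measurability, moments and expected gradients -/

section Gradients

variable {n d : ℕ} {Ω : Type*} [MeasurableSpace Ω] {P : Measure Ω} {Z : Fin n → Type*}
  [∀ i, MeasurableSpace (Z i)] {g : (i : Fin n) → Vec d → Z i → ℝ} {ζ : (i : Fin n) → Ω → Z i}
  {ℓ : (i : Fin n) → Z i → ℝ} {μ : ℝ} {xstar : Vec d}

/-- Each coordinate of the gradient is a pointwise limit of difference quotients with steps
`1/(k+1)`. -/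
lemma measurable_gradient {T : Type*} [MeasurableSpace T] {f : Vec d → T → ℝ}
    (hf : ∀ x, Measurable (f x)) {x : Vec d} (hd : ∀ t, DifferentiableAt ℝ (fun y => f y t) x) :
    Measurable fun t => gradient (fun y => f y t) x := by
  have dir : ∀ e : Vec d, Measurable fun t => (inner ℝ e (gradient (fun y => f y t) x) : ℝ) := by
    intro e
    have hlim : Filter.Tendsto (fun k : ℕ => (1 / ((k : ℝ) + 1))) Filter.atTop
        (nhdsWithin 0 {0}ᶜ) := by
      refine tendsto_nhdsWithin_iff.2 ⟨tendsto_one_div_add_atTop_nhds_zero_nat, ?_⟩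
      exact Filter.Eventually.of_forall fun k => by
        simp only [Set.mem_compl_iff, Set.mem_singleton_iff]; positivity
    refine measurable_of_tendsto_metrizable (f := fun (k : ℕ) t =>
      (1 / ((k : ℝ) + 1))⁻¹ * (f (x + (1 / ((k : ℝ) + 1)) • e) t - f x t)) (fun k => ?_) ?_
    · exact ((hf _).sub (hf _)).const_mul _
    · refine tendsto_pi_nhds.2 fun t => ?_
      have h1 := ((hd t).hasGradientAt.hasFDerivAt.hasLineDerivAt e).tendsto_slope_zero
      rw [InnerProductSpace.toDual_apply_apply, real_inner_comm] at h1
      exact h1.comp hlim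
  set b := EuclideanSpace.basisFun (Fin d) ℝ
  have : (fun t => gradient (fun y => f y t) x) =
      fun t => ∑ j, (inner ℝ (b j) (gradient (fun y => f y t) x) : ℝ) • b j :=
    funext fun t => (b.sum_repr' _).symm
  rw [this]
  exact Finset.measurable_fun_sum _ fun j _ => (dir (b j)).smul_const _

lemma continuous_of_norm_sub_le {E E' : Type*} [NormedAddCommGroup E] [NormedAddCommGroup E']
    {f : E → E'} {L : ℝ} (h : ∀ x y, ‖f x - f y‖ ≤ L * ‖x - y‖) : Continuous f := by
  refine (LipschitzWith.of_dist_le_mul (K := L.toNNReal) fun x y => ?_).continuous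
  rw [dist_eq_norm, dist_eq_norm]
  refine (h x y).trans ?_
  gcongr
  exact Real.le_coe_toNNReal L

lemma sq_le_one_add_rpow {t p : ℝ} (ht : 0 ≤ t) (hp : 2 < p) : t ^ 2 ≤ 1 + t ^ p := by
  rcases le_total t 1 with h | h
  · have : t ^ 2 ≤ 1 := pow_le_one₀ ht h
    have : 0 ≤ t ^ p := Real.rpow_nonneg ht p
    linarith
  · have : t ^ (2 : ℝ) ≤ t ^ p := Real.rpow_le_rpow_of_exponent_le h hp.le
    rw [Real.rpow_two] at this
    linarith

variable (hobj : ObjectiveAssumption P g ζ ℓ μ xstar)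
include hobj

lemma measurable_stochGrad (i : Fin n) : Measurable (Function.uncurry (stochGrad g i)) :=
  measurable_uncurry_of_continuous_of_measurable
    (fun z => continuous_of_norm_sub_le (hobj.lipschitz i z))
    fun x => measurable_gradient (hobj.g_meas i) fun z => hobj.g_diff i z x

lemma stochGrad_comp_measurable {Ω' : Type*} {m : MeasurableSpace Ω'} (i : Fin n)
    {X : Ω' → Vec d} {z : Ω' → Z i} (hX : Measurable X) (hz : Measurable z) :
    Measurable fun ω => stochGrad g i (X ω) (z ω) :=
  (measurable_stochGrad hobj i).comp (hX.prodMk hz)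

variable [IsProbabilityMeasure P]

lemma exists_variance_le : ∃ σ : ℝ, 0 ≤ σ ∧ ∀ i x,
    Integrable (fun ω => ‖stochGrad g i x (ζ i ω) - gradient (localCost P g ζ i) x‖ ^ 2) P ∧
    ∫ ω, ‖stochGrad g i x (ζ i ω) - gradient (localCost P g ζ i) x‖ ^ 2 ∂P ≤ σ := by
  obtain ⟨p, U, hp, hU, h, -⟩ := hobj.moments
  refine ⟨1 + U ^ (p / 2), by positivity, fun i x => ?_⟩
  obtain ⟨hi, hle⟩ := h i x
  have meas : Measurable fun ω => stochGrad g i x (ζ i ω) - gradient (localCost P g ζ i) x :=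
    (stochGrad_comp_measurable hobj i measurable_const (hobj.ζ_meas i)).sub_const _
  have hi1 := (integrable_const (1 : ℝ)).add hi (μ := P)
  have hint := hi1.mono' (g := _) (meas.norm.pow_const 2).aestronglyMeasurable
    (Filter.Eventually.of_forall fun ω => by
      rw [Real.norm_of_nonneg (by positivity)]
      exact sq_le_one_add_rpow (norm_nonneg _) hp)
  refine ⟨hint, (integral_mono hint hi1 fun ω =>
    sq_le_one_add_rpow (norm_nonneg _) hp).trans ?_⟩
  rw [integral_add' (integrable_const _) hi]
  simpa using hle

lemma lipConst_memLp (i : Fin n) : MemLp (fun ω => ℓ i (ζ i ω)) 2 P := by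
  obtain ⟨p, U, hp, hU, -, h⟩ := hobj.moments
  have meas : Measurable fun ω => ℓ i (ζ i ω) := (hobj.ℓ_meas i).comp (hobj.ζ_meas i)
  rw [memLp_two_iff_integrable_sq meas.aestronglyMeasurable]
  refine ((integrable_const (1 : ℝ)).add (h i)).mono' (meas.pow_const 2).aestronglyMeasurable
    (Filter.Eventually.of_forall fun ω => ?_)
  rw [Real.norm_of_nonneg (by positivity)]
  exact sq_le_one_add_rpow (hobj.ℓ_pos i _).le hp

lemma stochGrad_memLp (i : Fin n) (x : Vec d) : MemLp (fun ω => stochGrad g i x (ζ i ω)) 2 P := by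
  obtain ⟨σ, -, h⟩ := exists_variance_le hobj
  have meas : Measurable fun ω => stochGrad g i x (ζ i ω) - gradient (localCost P g ζ i) x :=
    (stochGrad_comp_measurable hobj i measurable_const (hobj.ζ_meas i)).sub_const _
  have := ((memLp_two_iff_integrable_sq_norm meas.aestronglyMeasurable).2 (h i x).1).add
    (memLp_const (gradient (localCost P g ζ i) x))
  simpa [Pi.add_def] using this

/-- Differentiation under the integral: on the unit ball about `x` the gradients are dominated by
`‖∇g_i(x; ζ_i)‖ + ℓ_i(ζ_i)`. This is what makes the stochastic gradients unbiased. -/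
lemma hasGradientAt_localCost (i : Fin n) (x : Vec d) :
    HasGradientAt (localCost P g ζ i) (∫ ω, stochGrad g i x (ζ i ω) ∂P) x := by
  have hint : ∀ y, Integrable (fun ω => stochGrad g i y (ζ i ω)) P := fun y =>
    (stochGrad_memLp hobj i y).integrable one_le_two
  have hℓ : Integrable (fun ω => ℓ i (ζ i ω)) P := (lipConst_memLp hobj i).integrable one_le_two
  set D := InnerProductSpace.toDual ℝ (Vec d)
  have key := hasFDerivAt_integral_of_dominated_of_fderiv_le (μ := P) (x₀ := x)
    (F := fun y ω => g i y (ζ i ω)) (F' := fun y ω => D (stochGrad g i y (ζ i ω)))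
    (bound := fun ω => ‖stochGrad g i x (ζ i ω)‖ + ℓ i (ζ i ω))
    (Metric.ball_mem_nhds x one_pos)
    (Filter.Eventually.of_forall fun y => (hobj.g_integrable i y).aestronglyMeasurable)
    (hobj.g_integrable i x)
    (D.continuous.comp_aestronglyMeasurable (hint x).aestronglyMeasurable)
    (Filter.Eventually.of_forall fun ω y hy => ?_) ((hint x).norm.add hℓ)
    (Filter.Eventually.of_forall fun ω y _ => ?_)
  · rw [hasGradientAt_iff_hasFDerivAt]
    have e : D (∫ ω, stochGrad g i x (ζ i ω) ∂P) = ∫ ω, D (stochGrad g i x (ζ i ω)) ∂P :=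
      ((D.toContinuousLinearEquiv.toContinuousLinearMap).integral_comp_comm (hint x)).symm
    exact e ▸ key
  · rw [LinearIsometryEquiv.norm_map]
    have h1 := hobj.lipschitz i (ζ i ω) y x
    have h2 : ‖y - x‖ ≤ 1 := by rw [← dist_eq_norm]; exact (Metric.mem_ball.1 hy).le
    have h3 := mul_le_of_le_one_right (hobj.ℓ_pos i (ζ i ω)).le h2
    have h4 := norm_sub_norm_le (stochGrad g i y (ζ i ω)) (stochGrad g i x (ζ i ω))
    linarith
  · exact (hobj.g_diff i (ζ i ω) y).hasGradientAt.hasFDerivAt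

lemma gradient_localCost (i : Fin n) (x : Vec d) :
    gradient (localCost P g ζ i) x = ∫ ω, stochGrad g i x (ζ i ω) ∂P :=
  (hasGradientAt_localCost hobj i x).gradient

lemma gradient_cost (x : Vec d) :
    gradient (cost P g ζ) x = ∑ i, gradient (localCost P g ζ i) x := by
  refine HasGradientAt.gradient ?_
  rw [hasGradientAt_iff_hasFDerivAt, map_sum]
  have : cost P g ζ = fun x => ∑ j, localCost P g ζ j x := rfl
  rw [this]
  exact HasFDerivAt.fun_sum fun i _ =>
    (hasGradientAt_localCost hobj i x).differentiableAt.hasGradientAt.hasFDerivAt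

lemma exists_lipschitz_gradient : ∃ L : ℝ, 0 ≤ L ∧ ∀ i x y,
    ‖gradient (localCost P g ζ i) x - gradient (localCost P g ζ i) y‖ ≤ L * ‖x - y‖ := by
  have hpos : ∀ i, 0 ≤ ∫ ω, ℓ i (ζ i ω) ∂P := fun i =>
    integral_nonneg fun ω => (hobj.ℓ_pos i _).le
  refine ⟨∑ i, ∫ ω, ℓ i (ζ i ω) ∂P, Finset.sum_nonneg fun i _ => hpos i, fun i x y => ?_⟩
  have hint : ∀ y, Integrable (fun ω => stochGrad g i y (ζ i ω)) P := fun y =>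
    (stochGrad_memLp hobj i y).integrable one_le_two
  have hℓ : Integrable (fun ω => ℓ i (ζ i ω)) P := (lipConst_memLp hobj i).integrable one_le_two
  rw [gradient_localCost hobj, gradient_localCost hobj, ← integral_sub (hint x) (hint y)]
  calc _ ≤ ∫ ω, ℓ i (ζ i ω) * ‖x - y‖ ∂P :=
        norm_integral_le_of_norm_le (hℓ.mul_const _)
          (Filter.Eventually.of_forall fun ω => hobj.lipschitz i (ζ i ω) x y)
    _ = (∫ ω, ℓ i (ζ i ω) ∂P) * ‖x - y‖ := integral_mul_const _ _
    _ ≤ _ := by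
        gcongr
        exact Finset.single_le_sum (fun i _ => hpos i) (Finset.mem_univ i)

lemma gradient_cost_xstar : ∑ i, gradient (localCost P g ζ i) xstar = 0 := by
  rw [← gradient_cost hobj]
  have : IsLocalMin (cost P g ζ) xstar := Filter.Eventually.of_forall hobj.optimal
  rw [gradient, this.fderiv_eq_zero, map_zero]

/-- Strong convexity is used from `x` to `xstar` and back; the two halves `μ / 2` add up. -/
lemma strongly_monotone (x : Vec d) :
    μ * ‖x - xstar‖ ^ 2 ≤ inner ℝ (∑ i, gradient (localCost P g ζ i) x) (x - xstar) := by
  rw [← gradient_cost hobj]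
  have h1 := hobj.strong_convex x xstar
  have h2 := hobj.strong_convex xstar x
  rw [gradient_cost hobj xstar, gradient_cost_xstar hobj, inner_zero_left,
    norm_sub_rev xstar x] at h2
  have h3 : inner ℝ (gradient (cost P g ζ) x) (xstar - x) =
      -inner ℝ (gradient (cost P g ζ) x) (x - xstar) := by
    rw [← inner_neg_right, neg_sub]
  rw [h3] at h1
  linarith

end Gradients

/-! ### The filtration of the samples and freezing the past -/

section Sampling

variable {n : ℕ} {Ω : Type*} {Z : Fin n → Type*} [∀ i, MeasurableSpace (Z i)]

/-- The σ-algebra generated by the samples drawn before time `k`. -/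
@[reducible] def past (s : (i : Fin n) → ℕ → Ω → Z i) (k : ℕ) : MeasurableSpace Ω :=
  ⨆ t ∈ Set.Iio k, MeasurableSpace.comap (fun ω i => s i t ω) MeasurableSpace.pi

lemma past_mono (s : (i : Fin n) → ℕ → Ω → Z i) (k : ℕ) : past s k ≤ past s (k + 1) :=
  biSup_mono fun _ ht => lt_trans ht (Nat.lt_succ_self k)

lemma measurable_sample_past (s : (i : Fin n) → ℕ → Ω → Z i) (i : Fin n) (k : ℕ) :
    Measurable[past s (k + 1)] (s i k) := by
  have h1 : MeasurableSpace.comap (fun ω i => s i k ω) MeasurableSpace.pi ≤ past s (k + 1) :=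
    le_biSup (fun t => MeasurableSpace.comap (fun ω i => s i t ω) MeasurableSpace.pi)
      (Set.mem_Iio.2 (Nat.lt_succ_self k))
  have h2 : Measurable[MeasurableSpace.comap (fun ω i => s i k ω) MeasurableSpace.pi]
      (fun ω i => s i k ω) := comap_measurable _
  exact ((measurable_pi_apply i).comp h2).mono h1 le_rfl

variable [MeasurableSpace Ω] {P : Measure Ω} {ζ : (i : Fin n) → Ω → Z i}
  {s : (i : Fin n) → ℕ → Ω → Z i} (hs : IsSampling P ζ s)
include hs

lemma past_le (k : ℕ) : past s k ≤ ‹MeasurableSpace Ω› :=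
  iSup₂_le fun t _ => (measurable_pi_lambda _ fun i => hs.meas i t).comap_le

lemma indepFun_sample {S : Type*} [MeasurableSpace S] {Y : Ω → S} {k : ℕ}
    (hY : Measurable[past s k] Y) (i : Fin n) : IndepFun Y (s i k) P := by
  have h1 := hs.indep.iIndep
  have h2 := indep_iSup_of_disjoint
    (fun t => (measurable_pi_lambda _ fun i => hs.meas i t).comap_le) h1
    (S := Set.Iio k) (T := {k}) (by simp)
  rw [IndepFun_iff_Indep]
  refine indep_of_indep_of_le_left (indep_of_indep_of_le_right h2 ?_) hY.comap_le
  have h3 : MeasurableSpace.comap (s i k) inferInstance ≤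
      MeasurableSpace.comap (fun ω i => s i k ω) MeasurableSpace.pi := by
    have : Measurable[MeasurableSpace.comap (fun ω i => s i k ω) MeasurableSpace.pi]
      (fun ω i => s i k ω) := comap_measurable _
    exact ((measurable_pi_apply i).comp this).comap_le
  exact h3.trans (le_biSup (fun t => MeasurableSpace.comap (fun ω i => s i t ω)
    MeasurableSpace.pi) (Set.mem_singleton k))

variable [IsProbabilityMeasure P]

lemma map_prod_sample {S : Type*} [MeasurableSpace S] {Y : Ω → S} {k : ℕ}
    (hY : Measurable[past s k] Y) (i : Fin n) :
    P.map (fun ω => (Y ω, s i k ω)) = (P.map Y).prod (P.map (ζ i)) := by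
  have hY' : Measurable Y := hY.mono (past_le hs k) le_rfl
  rw [← (hs.law i k).map_eq]
  exact (indepFun_iff_map_prod_eq_prod_map_map hY'.aemeasurable (hs.meas i k).aemeasurable).1
    (indepFun_sample hs hY i)

/-- A variable of the past and the fresh sample have a product law, so by Tonelli a bound valid for
every frozen value of the past survives averaging. -/
lemma lintegral_sample_le {S : Type*} [MeasurableSpace S] {Y : Ω → S} {k : ℕ}
    (hY : Measurable[past s k] Y) {i : Fin n} (hζ : Measurable (ζ i)) {φ : S × Z i → ENNReal}
    (hφ : Measurable φ) {c : ENNReal} (hc : ∀ y, ∫⁻ ω, φ (y, ζ i ω) ∂P ≤ c) :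
    ∫⁻ ω, φ (Y ω, s i k ω) ∂P ≤ c := by
  have hY' : Measurable Y := hY.mono (past_le hs k) le_rfl
  rw [← lintegral_map (f := φ) (g := fun ω => (Y ω, s i k ω)) hφ (hY'.prodMk (hs.meas i k)),
    map_prod_sample hs hY i, lintegral_prod _ hφ.aemeasurable]
  have : IsProbabilityMeasure (P.map Y) := Measure.isProbabilityMeasure_map hY'.aemeasurable
  calc _ ≤ ∫⁻ _, c ∂(P.map Y) := lintegral_mono fun y => by
        exact (lintegral_map (f := fun z => φ (y, z)) (hφ.comp measurable_prodMk_left) hζ).trans_le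
          (hc y)
    _ = c := by simp

lemma integral_sample_eq_zero {S : Type*} [MeasurableSpace S] {Y : Ω → S} {k : ℕ}
    (hY : Measurable[past s k] Y) {i : Fin n} (hζ : Measurable (ζ i)) {φ : S × Z i → ℝ}
    (hφ : Measurable φ) (hint : Integrable (fun ω => φ (Y ω, s i k ω)) P)
    (h0 : ∀ y, ∫ ω, φ (y, ζ i ω) ∂P = 0) :
    ∫ ω, φ (Y ω, s i k ω) ∂P = 0 := by
  have hY' : Measurable Y := hY.mono (past_le hs k) le_rfl
  have hm : Measurable fun ω => (Y ω, s i k ω) := hY'.prodMk (hs.meas i k)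
  have e := integral_map (μ := P) hm.aemeasurable hφ.aestronglyMeasurable (f := φ)
  have hint' : Integrable φ ((P.map Y).prod (P.map (ζ i))) := by
    rw [← map_prod_sample hs hY i]
    exact (integrable_map_measure hφ.aestronglyMeasurable hm.aemeasurable).2 hint
  have := Measure.isProbabilityMeasure_map hY'.aemeasurable (μ := P)
  have := Measure.isProbabilityMeasure_map hζ.aemeasurable (μ := P)
  rw [← e, map_prod_sample hs hY i, integral_prod _ hint']
  refine integral_eq_zero_of_ae (Filter.Eventually.of_forall fun y => ?_)
  have h1 : Measurable fun z => φ (y, z) := hφ.comp measurable_prodMk_left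
  simp only [Pi.zero_apply]
  rw [integral_map hζ.aemeasurable h1.aestronglyMeasurable]
  exact h0 y

end Sampling

/-! ### Adaptedness, square integrability and noise of the iterates -/

section Iterates

lemma memLp_act {n d : ℕ} {Ω : Type*} [MeasurableSpace Ω] (M : Matrix (Fin n) (Fin n) ℝ)
    {P : Measure Ω} {X : Ω → Fin n → Vec d} (hX : MemLp X 2 P) :
    MemLp (fun ω => act M (X ω)) 2 P := by
  obtain ⟨c, -, hc⟩ := exists_norm_act_le (E := Vec d) M
  exact hX.of_le_mul ((continuous_act M).comp_aestronglyMeasurable hX.aestronglyMeasurable)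
    (Filter.Eventually.of_forall fun ω => hc _)

variable {n d : ℕ} {Ω : Type*} {Z : Fin n → Type*}
  (A B : Matrix (Fin n) (Fin n) ℝ) (g : (i : Fin n) → Vec d → Z i → ℝ) (α : ℕ → ℝ)
  (x0 : Fin n → Vec d) (s : (i : Fin n) → ℕ → Ω → Z i)

/-- The stack of all agents at time `k`. -/
def agents (k : ℕ) (ω : Ω) : Fin n → Vec d := fun i => agent A B g α x0 s i k ω

/-- The stack of the stochastic gradients sampled at time `k`. -/
def grads (k : ℕ) (ω : Ω) : Fin n → Vec d :=
  fun i => stochGrad g i (agents A B g α x0 s k ω i) (s i k ω)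

/-- The part of the trackers that depends on the past samples only. -/
def residual (k : ℕ) (ω : Ω) : Fin n → Vec d :=
  (iter A B g α x0 (fun j t => s j t ω) k).2 - grads A B g α x0 s k ω

lemma residual_zero (ω : Ω) : residual A B g α x0 s 0 ω = 0 := by
  ext1 i
  simp [residual, grads, agents, agent, iter]

lemma agents_succ (k : ℕ) (ω : Ω) : agents A B g α x0 s (k + 1) ω =
    act A (agents A B g α x0 s k ω) -
      α k • (residual A B g α x0 s k ω + grads A B g α x0 s k ω) := by
  rw [residual, sub_add_cancel]
  rfl

lemma residual_succ (k : ℕ) (ω : Ω) : residual A B g α x0 s (k + 1) ω =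
    act B (residual A B g α x0 s k ω + grads A B g α x0 s k ω) - grads A B g α x0 s k ω := by
  rw [residual, residual, sub_add_cancel]
  ext1 i
  simp only [Pi.sub_apply, act_apply, iter, grads, agents, agent]
  abel

lemma sum_residual (hB : ∀ j, ∑ i, B i j = 1) (k : ℕ) (ω : Ω) :
    ∑ i, residual A B g α x0 s k ω i = 0 := by
  induction k with
  | zero => simp [residual_zero]
  | succ k ih =>
    rw [residual_succ]
    exact sum_residual_step hB ih _

variable [MeasurableSpace Ω] [∀ i, MeasurableSpace (Z i)] {P : Measure Ω}
  {ζ : (i : Fin n) → Ω → Z i} {ℓ : (i : Fin n) → Z i → ℝ} {μ : ℝ} {xstar : Vec d} {g} {s}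
  (hobj : ObjectiveAssumption P g ζ ℓ μ xstar)
include hobj

lemma measurable_state (k : ℕ) : Measurable[past s k] (agents A B g α x0 s k) ∧
    Measurable[past s k] (residual A B g α x0 s k) := by
  induction k with
  | zero =>
    have h1 : agents A B g α x0 s 0 = fun _ => x0 := rfl
    have h2 : residual A B g α x0 s 0 = fun _ => 0 := funext (residual_zero A B g α x0 s)
    rw [h1, h2]
    exact ⟨measurable_const, measurable_const⟩
  | succ k ih =>
    have hx : Measurable[past s (k + 1)] (agents A B g α x0 s k) :=
      ih.1.mono (past_mono s k) le_rfl
    have hw : Measurable[past s (k + 1)] (residual A B g α x0 s k) :=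
      ih.2.mono (past_mono s k) le_rfl
    have hu := measurable_stochGrad hobj
    -- From here on, measurability on `Ω` refers to the samples up to time `k` inclusive.
    let _ := past s (k + 1)
    have hG : Measurable (grads A B g α x0 s k) :=
      measurable_pi_lambda _ fun i => (hu i).comp
        (((measurable_pi_apply i).comp hx).prodMk (measurable_sample_past s i k))
    rw [funext (agents_succ A B g α x0 s k), funext (residual_succ A B g α x0 s k)]
    exact ⟨((continuous_act A).measurable.comp hx).sub ((hw.add hG).const_smul (α k)),
      ((continuous_act B).measurable.comp (hw.add hG)).sub hG⟩

lemma memLp_gradient [IsProbabilityMeasure P] {X : Ω → Vec d} (hX : MemLp X 2 P)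
    (hX' : Measurable X) (i : Fin n) :
    MemLp (fun ω => gradient (localCost P g ζ i) (X ω)) 2 P := by
  obtain ⟨L, hL0, hL⟩ := exists_lipschitz_gradient hobj
  have hF : Measurable (gradient (localCost P g ζ i)) :=
    (continuous_of_norm_sub_le (hL i)).measurable
  have h1 : MemLp (fun ω => L * ‖X ω - xstar‖ + ‖gradient (localCost P g ζ i) xstar‖) 2 P :=
    ((hX.sub (memLp_const xstar)).norm.const_mul L).add (memLp_const _)
  refine h1.of_le (hF.comp hX').aestronglyMeasurable (Filter.Eventually.of_forall fun ω => ?_)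
  rw [Real.norm_of_nonneg (by positivity)]
  have h2 := norm_sub_norm_le (gradient (localCost P g ζ i) (X ω))
    (gradient (localCost P g ζ i) xstar)
  have h3 := hL i (X ω) xstar
  linarith

variable (hs : IsSampling P ζ s) [IsProbabilityMeasure P]
include hs

/-- The noise of the stochastic gradients has uniformly bounded variance. -/
lemma exists_noise_le : ∃ σ : ℝ, 0 ≤ σ ∧ ∀ i k,
    MemLp (fun ω => grads A B g α x0 s k ω i -
      gradient (localCost P g ζ i) (agents A B g α x0 s k ω i)) 2 P ∧
    ∫ ω, ‖grads A B g α x0 s k ω i -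
      gradient (localCost P g ζ i) (agents A B g α x0 s k ω i)‖ ^ 2 ∂P ≤ σ := by
  obtain ⟨σ, hσ, hvar⟩ := exists_variance_le hobj
  obtain ⟨L, -, hL⟩ := exists_lipschitz_gradient hobj
  refine ⟨σ, hσ, fun i k => ?_⟩
  have hx := (measurable_pi_apply i).comp (measurable_state A B α x0 hobj (s := s) k).1
  have hx' : Measurable fun ω => agents A B g α x0 s k ω i := hx.mono (past_le hs k) le_rfl
  have hF : Measurable (gradient (localCost P g ζ i)) :=
    (continuous_of_norm_sub_le (hL i)).measurable
  set φ : Vec d × Z i → ENNReal := fun q =>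
    ENNReal.ofReal (‖stochGrad g i q.1 q.2 - gradient (localCost P g ζ i) q.1‖ ^ 2) with hφ
  have hφm : Measurable φ := ((((measurable_stochGrad hobj i).sub
    (hF.comp measurable_fst)).norm).pow_const 2).ennreal_ofReal
  have hle := lintegral_sample_le hs hx (hobj.ζ_meas i) hφm (c := ENNReal.ofReal σ) fun y => by
    rw [hφ, ← ofReal_integral_eq_lintegral_ofReal (hvar i y).1
      (Filter.Eventually.of_forall fun _ => by positivity)]
    exact ENNReal.ofReal_le_ofReal (hvar i y).2
  have hm : Measurable fun ω => grads A B g α x0 s k ω i -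
      gradient (localCost P g ζ i) (agents A B g α x0 s k ω i) :=
    (stochGrad_comp_measurable hobj i hx' (hs.meas i k)).sub (hF.comp hx')
  have hint : Integrable (fun ω => ‖grads A B g α x0 s k ω i -
      gradient (localCost P g ζ i) (agents A B g α x0 s k ω i)‖ ^ 2) P := by
    refine ⟨(hm.norm.pow_const 2).aestronglyMeasurable, ?_⟩
    rw [hasFiniteIntegral_iff_ofReal (Filter.Eventually.of_forall fun _ => by positivity)]
    exact hle.trans_lt ENNReal.ofReal_lt_top
  refine ⟨(memLp_two_iff_integrable_sq_norm hm.aestronglyMeasurable).2 hint, ?_⟩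
  rw [integral_eq_lintegral_of_nonneg_ae (Filter.Eventually.of_forall fun _ => by positivity)
    (hm.norm.pow_const 2).aestronglyMeasurable]
  exact ENNReal.toReal_le_of_le_ofReal hσ hle

lemma memLp_grads {k : ℕ} (hX : MemLp (agents A B g α x0 s k) 2 P) :
    MemLp (grads A B g α x0 s k) 2 P := by
  obtain ⟨σ, -, h⟩ := exists_noise_le A B α x0 hobj hs
  refine memLp_pi_iff.2 fun i => ?_
  have hx' : Measurable fun ω => agents A B g α x0 s k ω i :=
    ((measurable_pi_apply i).comp (measurable_state A B α x0 hobj k).1).mono (past_le hs k) le_rfl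
  have := (h i k).1.add (memLp_gradient hobj (memLp_pi_iff.1 hX i) hx' i)
  simpa [Pi.add_def] using this

lemma memLp_state (k : ℕ) :
    MemLp (agents A B g α x0 s k) 2 P ∧ MemLp (residual A B g α x0 s k) 2 P := by
  induction k with
  | zero =>
    have h1 : agents A B g α x0 s 0 = fun _ => x0 := rfl
    have h2 : residual A B g α x0 s 0 = fun _ => 0 := funext (residual_zero A B g α x0 s)
    rw [h1, h2]
    exact ⟨memLp_const _, memLp_const _⟩
  | succ k ih =>
    have hG := memLp_grads A B α x0 hobj hs ih.1
    rw [funext (agents_succ A B g α x0 s k), funext (residual_succ A B g α x0 s k)]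
    exact ⟨(memLp_act A ih.1).sub ((ih.2.add hG).const_smul (α k)),
      (memLp_act B (ih.2.add hG)).sub hG⟩

/-- The noise is orthogonal to the square-integrable functions of the past. -/
lemma integral_inner_noise {k : ℕ} {Y : Ω → Vec d} (hY : Measurable[past s k] Y)
    (hY2 : MemLp Y 2 P) :
    Integrable (fun ω => (inner ℝ (Y ω) (∑ i, (grads A B g α x0 s k ω i -
      gradient (localCost P g ζ i) (agents A B g α x0 s k ω i))) : ℝ)) P ∧
    ∫ ω, (inner ℝ (Y ω) (∑ i, (grads A B g α x0 s k ω i -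
      gradient (localCost P g ζ i) (agents A B g α x0 s k ω i))) : ℝ) ∂P = 0 := by
  obtain ⟨σ, -, h⟩ := exists_noise_le A B α x0 hobj hs
  obtain ⟨L, -, hL⟩ := exists_lipschitz_gradient hobj
  have int : ∀ i, Integrable (fun ω => (inner ℝ (Y ω) (grads A B g α x0 s k ω i -
      gradient (localCost P g ζ i) (agents A B g α x0 s k ω i)) : ℝ)) P := fun i => by
    refine (hY2.norm.integrable_mul (h i k).1.norm).mono'
      (hY2.aestronglyMeasurable.inner (h i k).1.aestronglyMeasurable)
      (Filter.Eventually.of_forall fun ω => ?_)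
    exact abs_real_inner_le_norm _ _
  simp only [inner_sum]
  refine ⟨integrable_finsetSum _ fun i _ => int i, ?_⟩
  rw [integral_finsetSum _ fun i _ => int i]
  refine Finset.sum_eq_zero fun i _ => ?_
  have hx := (measurable_pi_apply i).comp (measurable_state A B α x0 hobj (s := s) k).1
  have hF : Measurable (gradient (localCost P g ζ i)) :=
    (continuous_of_norm_sub_le (hL i)).measurable
  have hp : Measurable[past s k] fun ω => (Y ω, agents A B g α x0 s k ω i) := hY.prodMk hx
  refine integral_sample_eq_zero hs hp (hobj.ζ_meas i)
    (φ := fun q : (Vec d × Vec d) × Z i => (inner ℝ q.1.1 (stochGrad g i q.1.2 q.2 -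
      gradient (localCost P g ζ i) q.1.2) : ℝ)) ?_ (int i) fun y => ?_
  · exact (measurable_fst.comp measurable_fst).inner
      ((stochGrad_comp_measurable hobj i (measurable_snd.comp measurable_fst) measurable_snd).sub
        (hF.comp (measurable_snd.comp measurable_fst)))
  · have hi : Integrable (fun ω => stochGrad g i y.2 (ζ i ω)) P :=
      (stochGrad_memLp hobj i y.2).integrable one_le_two
    have e := integral_inner (𝕜 := ℝ) (hi.sub (integrable_const
      (gradient (localCost P g ζ i) y.2))) y.1
    simp only [Pi.sub_apply] at e
    -- With the past frozen at `y`, the noise has mean zero because the gradient of the local cost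
    -- is the expected stochastic gradient.
    rw [e, integral_sub hi (integrable_const _), gradient_localCost hobj]
    simp

end Iterates

/-! ### From the Lyapunov function back to the iterates -/

section Bounds

variable {n : ℕ} {E : Type*} [NormedAddCommGroup E] [NormedSpace ℝ E]

lemma sq_norm_sub_le_lyapunov (hn : 0 < n) {u h : Fin n → ℝ} {xstar : E}
    {NA NB : (Fin n → E) → ℝ} (hA : ∀ x, ‖x‖ ≤ NA x) (hB : ∀ x, ‖x‖ ≤ NB x) {K α : ℝ}
    (hK : 0 < K) (hα : 0 ≤ α) (x w : Fin n → E) :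
    ‖wavg u x - xstar‖ ^ 2 ≤
      3 * (1 + (∑ i, |h i|) ^ 2 / K) *
        (‖err u h xstar α x w‖ ^ 2 + NA (dev u x) ^ 2 + K * α ^ 2 * NB w ^ 2) ∧
    ∀ i, ‖x i - xstar‖ ^ 2 ≤
      3 * (1 + (∑ i, |h i|) ^ 2 / K) *
        (‖err u h xstar α x w‖ ^ 2 + NA (dev u x) ^ 2 + K * α ^ 2 * NB w ^ 2) := by
  set H := ∑ i, |h i| with hH
  set e := ‖err u h xstar α x w‖
  have hH0 : 0 ≤ H := by positivity
  have bound : (‖dev u x‖ + e + α * (H * ‖w‖)) ^ 2 ≤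
      3 * (1 + H ^ 2 / K) * (e ^ 2 + NA (dev u x) ^ 2 + K * α ^ 2 * NB w ^ 2) := by
    have h1 := pow_le_pow_left₀ (norm_nonneg _) (hA (dev u x)) 2
    have h2 := pow_le_pow_left₀ (norm_nonneg _) (hB w) 2
    have h3 : (α * (H * ‖w‖)) ^ 2 ≤ H ^ 2 / K * (K * α ^ 2 * NB w ^ 2) := by
      calc (α * (H * ‖w‖)) ^ 2 = H ^ 2 * α ^ 2 * ‖w‖ ^ 2 := by ring
        _ ≤ H ^ 2 * α ^ 2 * NB w ^ 2 := by gcongr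
        _ = _ := by field_simp
    have h4 : 0 ≤ H ^ 2 / K * (e ^ 2 + NA (dev u x) ^ 2) := by positivity
    have h5 : 0 ≤ K * α ^ 2 * NB w ^ 2 := by positivity
    linarith [add_three_sq_le ‖dev u x‖ e (α * (H * ‖w‖))]
  refine ⟨?_, fun i => ?_⟩
  · refine (pow_le_pow_left₀ (norm_nonneg _) ?_ 2).trans bound
    have hn1 : (1 : ℝ) ≤ n := by exact_mod_cast hn
    have eq : wavg u x - xstar = err u h xstar α x w + (α / n) • ∑ i, h i • w i := by
      simp only [err]; abel
    have h1 : ‖(α / n) • ∑ i, h i • w i‖ ≤ α * (H * ‖w‖) := by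
      rw [norm_smul, Real.norm_of_nonneg (by positivity)]
      have := norm_sum_smul_le h w
      have : α / n ≤ α := div_le_self hα hn1
      gcongr
    rw [eq]
    linarith [norm_add_le (err u h xstar α x w) ((α / n) • ∑ i, h i • w i),
      norm_nonneg (dev u x)]
  · exact (pow_le_pow_left₀ (norm_nonneg _) (norm_sub_le_err hn u h xstar hα x w i) 2).trans bound

end Bounds

/-! ### Taking expectations in the Lyapunov inequality -/

section Convergence

variable {n d : ℕ} {Ω : Type*} [MeasurableSpace Ω] {P : Measure Ω}

lemma memLp_err (u h : Fin n → ℝ) (xstar : Vec d) (α : ℝ) {X W : Ω → Fin n → Vec d}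
    [IsFiniteMeasure P] (hX : MemLp X 2 P) (hW : MemLp W 2 P) :
    MemLp (fun ω => err u h xstar α (X ω) (W ω)) 2 P := by
  have comb : ∀ (c : ℝ) (a : Fin n → ℝ) {Y : Ω → Fin n → Vec d}, MemLp Y 2 P →
      MemLp (fun ω => c • ∑ i, a i • Y ω i) 2 P := fun c a Y hY =>
    (memLp_finsetSum _ fun i _ => (memLp_pi_iff.1 hY i).const_smul (a i)).const_smul c
  exact ((comb _ u hX).sub (comb _ h hW)).sub (memLp_const xstar)

lemma IsContractingNorm.memLp {M : Matrix (Fin n) (Fin n) ℝ} {N : (Fin n → Vec d) → ℝ} {ρ C : ℝ}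
    (hN : IsContractingNorm M N ρ C) {X : Ω → Fin n → Vec d} (hX : MemLp X 2 P) :
    MemLp (fun ω => N (X ω)) 2 P :=
  hX.of_le_mul (hN.cont.comp_aestronglyMeasurable hX.aestronglyMeasurable)
    (Filter.Eventually.of_forall fun ω => by
      rw [Real.norm_of_nonneg ((norm_nonneg _).trans (hN.lower _))]
      exact hN.upper _)

lemma memLp_dev (u : Fin n → ℝ) {X : Ω → Fin n → Vec d} (hX : MemLp X 2 P) :
    MemLp (fun ω => dev u (X ω)) 2 P := by
  simp only [dev_eq_act]
  exact memLp_act _ hX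

variable {Z : Fin n → Type*} [∀ i, MeasurableSpace (Z i)] [IsProbabilityMeasure P]
  {g : (i : Fin n) → Vec d → Z i → ℝ} {ζ : (i : Fin n) → Ω → Z i} {ℓ : (i : Fin n) → Z i → ℝ}
  {μ : ℝ} {xstar : Vec d} {A B : Matrix (Fin n) (Fin n) ℝ} {u v : Fin n → ℝ}
  {s : (i : Fin n) → ℕ → Ω → Z i}

/-- With vanishing step sizes that decrease slowly enough, the weighted average and all agents
converge in mean square at the rate of the step sizes. -/
theorem meanSquareRate_of_slow_steps (hobj : ObjectiveAssumption P g ζ ℓ μ xstar)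
    (hAB : WeightAssumption A B) (hu : IsLeftPerron A u) (hv : IsRightPerron B v)
    (hs : IsSampling P ζ s) (x0 : Fin n → Vec d) {α : ℕ → ℝ} (hpos : ∀ k, 0 < α k)
    (hanti : ∀ k, α (k + 1) ≤ α k) (hlim : Filter.Tendsto α Filter.atTop (nhds 0)) {m' : ℝ}
    (hm' : m' < dotProduct u v / n ^ 2 * μ)
    (hslow : ∀ᶠ k in Filter.atTop, α k - α (k + 1) ≤ m' * α k ^ 2) :
    MeanSquareRate P (avg A B u g α x0 s) xstar α 0 ∧
      ∀ i, MeanSquareRate P (agent A B g α x0 s i) xstar α 0 := by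
  have hn := hAB.pos
  have hp := dotProduct_pos hAB hu hv
  have hμ := hobj.μ_pos
  obtain ⟨h, hh⟩ := exists_correction hAB u hv
  obtain ⟨kA, hkA⟩ := exists_pow_sum_le_A hAB hu
  obtain ⟨kB, hkB⟩ := exists_pow_sum_le_B hAB hv
  obtain ⟨NA, ρA, CA, hNA⟩ := exists_contractingNorm (E := Vec d) _ hkA
  obtain ⟨NB, ρB, CB, hNB⟩ := exists_contractingNorm (E := Vec d) _ hkB
  obtain ⟨L, hL0, hL⟩ := exists_lipschitz_gradient hobj
  -- The one-step bound needs a nonnegative `κ`, while `m'` may be negative; `max m' 0` is used.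
  obtain ⟨K, C, α₀, hK, hC, hα₀, step⟩ := exists_lyapunov_step hAB hu hp hh hNA hNB hL0 hL
    (gradient_cost_xstar hobj) hμ (strongly_monotone hobj) (le_max_right m' 0)
  obtain ⟨σ, hσ, noise⟩ := exists_noise_le A B α x0 hobj hs
  set X := agents A B g α x0 s with hX
  set W := residual A B g α x0 s with hW
  set G := grads A B g α x0 s with hG
  set F := fun i => gradient (localCost P g ζ i) with hF
  set m := dotProduct u v / (n : ℝ) ^ 2 * μ with hm
  set β := dotProduct u v / (n : ℝ) ^ 2 with hβ
  have state := memLp_state A B α x0 hobj hs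
  set V : ℕ → Ω → ℝ := fun k ω => lyapunov u h xstar NA NB K (α k) (X k ω) (W k ω) with hV
  have memE : ∀ k, MemLp (fun ω => err u h xstar (α k) (X k ω) (W k ω)) 2 P := fun k =>
    memLp_err u h xstar (α k) (state k).1 (state k).2
  have intV : ∀ k, Integrable (V k) P := fun k =>
    ((memE k).integrable_norm_pow two_ne_zero |>.add
      (hNA.memLp (memLp_dev u (state k).1)).integrable_sq).add
      ((hNB.memLp (state k).2).integrable_sq.const_mul (K * α k ^ 2))
  have intν : ∀ k i, Integrable (fun ω => ‖G k ω i - F i (X k ω i)‖ ^ 2) P := fun k i =>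
    (noise i k).1.integrable_norm_pow two_ne_zero
  have measX : ∀ k i, Measurable[past s k] fun ω => X k ω i := fun k i =>
    (measurable_pi_apply i).comp (measurable_state A B α x0 hobj k).1
  have cross : ∀ k, Integrable (fun ω => (inner ℝ (err u h xstar (α k) (X k ω) (W k ω) -
        (α k * β) • ∑ i, F i (X k ω i)) (∑ i, (G k ω i - F i (X k ω i))) : ℝ)) P ∧
      ∫ ω, (inner ℝ (err u h xstar (α k) (X k ω) (W k ω) -
        (α k * β) • ∑ i, F i (X k ω i)) (∑ i, (G k ω i - F i (X k ω i))) : ℝ) ∂P = 0 := by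
    intro k
    have hFm : ∀ i, Measurable (F i) := fun i => (continuous_of_norm_sub_le (hL i)).measurable
    refine integral_inner_noise A B α x0 hobj hs ?_ ?_
    · have hw : ∀ i, Measurable[past s k] fun ω => W k ω i := fun i =>
        (measurable_pi_apply i).comp (measurable_state A B α x0 hobj k).2
      have hx := measX k
      clear_value X W F
      let _ := past s k
      simp only [err, wavg]
      fun_prop
    · have sumF : MemLp (fun ω => ∑ i, F i (X k ω i)) 2 P :=
        memLp_finsetSum _ fun i _ => memLp_gradient hobj (memLp_pi_iff.1 (state k).1 i)
          ((measX k i).mono (past_le hs k) le_rfl) i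
      exact (memE k).sub (sumF.const_smul (α k * β))
  obtain ⟨k₀, hk₀⟩ : ∃ k₀, ∀ k, k₀ ≤ k → α k ≤ α₀ ∧ m * α k ≤ 1 ∧
      α k - α (k + 1) ≤ m' * α k ^ 2 := by
    have hm0 : 0 < m := by positivity
    have e1 : ∀ᶠ k in Filter.atTop, α k < α₀ := hlim.eventually (gt_mem_nhds hα₀)
    have e2 : ∀ᶠ k in Filter.atTop, α k < 1 / m :=
      hlim.eventually (gt_mem_nhds (by positivity))
    refine Filter.eventually_atTop.1 ?_
    filter_upwards [e1, e2, hslow] with k h1 h2 h3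
    exact ⟨h1.le, by rw [mul_comm]; exact ((lt_div_iff₀ hm0).1 h2).le, h3⟩
  have recursion : ∀ k, k₀ ≤ k → ∫ ω, V (k + 1) ω ∂P ≤
      (1 - m * α k) * ∫ ω, V k ω ∂P + C * (1 + n * σ) * α k ^ 2 := by
    intro k hk
    obtain ⟨h1, -, h3⟩ := hk₀ k hk
    have pt : ∀ ω, V (k + 1) ω ≤ (1 - m * α k) * V k ω
        + C * α k ^ 2 * (1 + ∑ i, ‖G k ω i - F i (X k ω i)‖ ^ 2)
        - 2 * (α k * β) * inner ℝ (err u h xstar (α k) (X k ω) (W k ω) -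
        (α k * β) • ∑ i, F i (X k ω i)) (∑ i, (G k ω i - F i (X k ω i))) := by
      intro ω
      have h4 : α k - α (k + 1) ≤ max m' 0 * α k ^ 2 :=
        h3.trans (by gcongr; exact le_max_left _ _)
      have := step (α k) (α (k + 1)) (hpos k) h1 (hpos _).le (hanti k) h4 (X k ω) (W k ω)
        (G k ω) (sum_residual A B g α x0 s hAB.B_col k ω)
      rw [← agents_succ A B g α x0 s, ← residual_succ A B g α x0 s] at this
      exact this
    have i1 := (intV k).const_mul (1 - m * α k)
    have i2 := ((integrable_const (1 : ℝ)).add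
      (integrable_finsetSum Finset.univ fun i _ => intν k i)).const_mul (C * α k ^ 2) (μ := P)
    -- This first-order noise term would be of size `α`; it disappears from the integrated
    -- inequality through `(cross k).2`.
    have i3 := (cross k).1.const_mul (2 * (α k * β))
    have h5 := integral_mono (intV (k + 1)) ((i1.add i2).sub i3) pt
    rw [integral_sub' (i1.add i2) i3, integral_add' i1 i2, integral_const_mul, integral_const_mul,
      integral_const_mul, (cross k).2, integral_add' (integrable_const _)
      (integrable_finsetSum _ fun i _ => intν k i), integral_finsetSum _ fun i _ => intν k i] at h5
    have h6 : ∑ i, ∫ ω, ‖G k ω i - F i (X k ω i)‖ ^ 2 ∂P ≤ n * σ := by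
      refine (Finset.sum_le_sum fun i _ => (noise i k).2).trans_eq ?_
      simp
    have h7 : C * α k ^ 2 * (1 + ∑ i, ∫ ω, ‖G k ω i - F i (X k ω i)‖ ^ 2 ∂P) ≤
        C * α k ^ 2 * (1 + n * σ) := by gcongr
    simp only [integral_const, probReal_univ, smul_eq_mul, one_mul] at h5
    linarith
  obtain ⟨M, hM, hVM⟩ := exists_le_mul_of_recursion (V := fun k => ∫ ω, V k ω ∂P) hm'
    (by positivity) hpos (fun k hk => (hk₀ k hk).2.1) (fun k hk => (hk₀ k hk).2.2) recursion
  set Q := 3 * (1 + (∑ i, |h i|) ^ 2 / K) with hQ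
  have hQ0 : 0 < Q := by positivity
  have conclude : ∀ (Y : ℕ → Ω → Vec d), (∀ k, AEStronglyMeasurable (Y k) P) →
      (∀ k ω, ‖Y k ω - xstar‖ ^ 2 ≤ Q * V k ω) → MeanSquareRate P Y xstar α 0 := by
    intro Y hY hle
    have int : ∀ k, Integrable (fun ω => ‖Y k ω - xstar‖ ^ 2) P := fun k =>
      ((intV k).const_mul Q).mono' (((hY k).sub aestronglyMeasurable_const).norm.pow 2)
        (Filter.Eventually.of_forall fun ω => by
          rw [Real.norm_of_nonneg (by positivity)]
          exact hle k ω)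
    refine ⟨int, Q * M, by positivity, fun k _ => ?_⟩
    calc _ ≤ ∫ ω, Q * V k ω ∂P := integral_mono (int k) ((intV k).const_mul Q) (hle k)
      _ = Q * ∫ ω, V k ω ∂P := integral_const_mul _ _
      _ ≤ Q * (M * α k) := by gcongr; exact hVM k
      _ = Q * M * α k := by ring
  have bound := fun k ω => sq_norm_sub_le_lyapunov hn (u := u) (h := h) (xstar := xstar)
    hNA.lower hNB.lower hK (hpos k).le (X k ω) (W k ω)
  have hXi : ∀ k i, MemLp (fun ω => X k ω i) 2 P := fun k i => memLp_pi_iff.1 (state k).1 i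
  refine ⟨conclude _ (fun k => ?_) fun k ω => (bound k ω).1,
    fun i => conclude _ (fun k => (hXi k i).aestronglyMeasurable) fun k ω => (bound k ω).2 i⟩
  exact ((memLp_finsetSum _ fun i _ => (hXi k i).const_smul (u i)).const_smul
    (1 / (n : ℝ))).aestronglyMeasurable

end Convergence

/-! ### Decay of the polynomial step sizes -/

section StepSizes

lemma tendsto_div_rpow {a b r : ℝ} (hr : 0 < r) :
    Filter.Tendsto (fun k : ℕ => a / ((k : ℝ) + b) ^ r) Filter.atTop (nhds 0) :=
  Filter.Tendsto.const_div_atTop ((tendsto_rpow_atTop hr).comp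
    (Filter.tendsto_atTop_add_const_right _ b tendsto_natCast_atTop_atTop)) a

/-- For `r ≤ 1` one has `(t/(t+1))^r ≥ t/(t+1)`, so the relative decrease is at most that of the
harmonic case, below `1/t`. -/
lemma div_rpow_sub_le {a t r : ℝ} (ha : 0 ≤ a) (ht : 0 < t) (hr : r ≤ 1) :
    a / t ^ r - a / (t + 1) ^ r ≤ a / t ^ r * (1 / t) := by
  have h1 : t / (t + 1) ≤ (t / (t + 1)) ^ r := by
    have := Real.rpow_le_rpow_of_exponent_ge (show 0 < t / (t + 1) by positivity)
      ((div_le_one (by positivity)).2 (by linarith)) hr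
    rwa [Real.rpow_one] at this
  rw [Real.div_rpow ht.le (by positivity)] at h1
  have h2 : a / (t + 1) ^ r = a / t ^ r * (t ^ r / (t + 1) ^ r) := by field_simp
  have h3 : 1 - t / (t + 1) ≤ 1 / t := by
    have : 1 - t / (t + 1) = 1 / (t + 1) := by field_simp; ring
    rw [this]
    exact one_div_le_one_div_of_le ht (by linarith)
  rw [h2]
  calc a / t ^ r - a / t ^ r * (t ^ r / (t + 1) ^ r)
      = a / t ^ r * (1 - t ^ r / (t + 1) ^ r) := by ring
    _ ≤ a / t ^ r * (1 / t) := by gcongr; linarith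

/-- The relative decrease `1/t` equals `t^(r-1) · t^(-r)`, and `t^(r-1)` tends to zero, so any `ε`
is eventually enough. -/
lemma eventually_div_rpow_sub_le {a b r ε : ℝ} (ha : 0 < a) (hb : 0 < b) (hr : r < 1)
    (hε : 0 < ε) : ∀ᶠ k : ℕ in Filter.atTop,
      a / ((k : ℝ) + b) ^ r - a / (((k + 1 : ℕ) : ℝ) + b) ^ r ≤
        ε * (a / ((k : ℝ) + b) ^ r) ^ 2 := by
  have h1 := (tendsto_div_rpow (a := 1) (b := b) (show 0 < 1 - r by linarith)).eventually
    (gt_mem_nhds (show 0 < ε * a by positivity))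
  filter_upwards [h1] with k hk
  have ht : 0 < (k : ℝ) + b := by positivity
  have e1 : ((k + 1 : ℕ) : ℝ) + b = ((k : ℝ) + b) + 1 := by push_cast; ring
  rw [e1]
  refine (div_rpow_sub_le ha.le ht hr.le).trans ?_
  set t := (k : ℝ) + b
  have h2 : 1 / t ≤ ε * (a / t ^ r) := by
    rw [Real.rpow_sub ht, Real.rpow_one, one_div_div] at hk
    calc 1 / t = t ^ r / t * (1 / t ^ r) := by field_simp
      _ ≤ ε * a * (1 / t ^ r) := by gcongr
      _ = _ := by ring
  calc a / t ^ r * (1 / t) ≤ a / t ^ r * (ε * (a / t ^ r)) := by gcongr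
    _ = _ := by ring

lemma MeanSquareRate.of_harmonic {d : ℕ} {Ω : Type*} [MeasurableSpace Ω] {P : Measure Ω}
    {X : ℕ → Ω → Vec d} {xstar : Vec d} {a b : ℝ} (ha : 0 < a) (hb : 0 < b)
    (h : MeanSquareRate P X xstar (fun k => a / ((k : ℝ) + b)) 0) :
    MeanSquareRate P X xstar (fun k => 1 / (k : ℝ)) 1 := by
  obtain ⟨hint, C, hC, hle⟩ := h
  refine ⟨hint, C * a, by positivity, fun k hk => (hle k (Nat.zero_le k)).trans ?_⟩
  have hk' : (0 : ℝ) < k := by exact_mod_cast hk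
  calc C * (a / ((k : ℝ) + b)) ≤ C * (a / k) := by gcongr; linarith
    _ = C * a * (1 / k) := by ring

end StepSizes

end SAB

end

theorem theorem1 {n d : ℕ} {Ω : Type*} [MeasurableSpace Ω] (P : Measure Ω)
    [IsProbabilityMeasure P] {Z : Fin n → Type*} [∀ i, MeasurableSpace (Z i)]
    (g : (i : Fin n) → SAB.Vec d → Z i → ℝ) (ζ : (i : Fin n) → Ω → Z i)
    (ℓ : (i : Fin n) → Z i → ℝ) (μ : ℝ) (xstar : SAB.Vec d)
    (hobj : SAB.ObjectiveAssumption P g ζ ℓ μ xstar)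
    (A B : Matrix (Fin n) (Fin n) ℝ) (hAB : SAB.WeightAssumption A B)
    (u v : Fin n → ℝ) (hu : SAB.IsLeftPerron A u) (hv : SAB.IsRightPerron B v)
    (s : (i : Fin n) → ℕ → Ω → Z i) (hs : SAB.IsSampling P ζ s)
    (x0 : Fin n → SAB.Vec d) :
    (∀ a b α : ℝ, 0 < a → 0 < b → 1 / 2 < α → α < 1 →
      a / b ^ α ≤ min 1 (n / (dotProduct u v * SAB.lipConst P ζ ℓ)) →
      SAB.MeanSquareRate P
        (SAB.avg A B u g (fun k => a / ((k : ℝ) + b) ^ α) x0 s) xstar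
        (fun k => a / ((k : ℝ) + b) ^ α) 0) ∧
    (∀ a b : ℝ, 0 < a → 0 < b →
      (n : ℝ) ^ 2 / (dotProduct u v * μ) < a →
      a ≤ min 1 (n / (dotProduct u v * SAB.lipConst P ζ ℓ)) * b →
      SAB.MeanSquareRate P
        (SAB.avg A B u g (fun k => a / ((k : ℝ) + b)) x0 s) xstar
        (fun k => 1 / (k : ℝ)) 1 ∧
      ∀ i, SAB.MeanSquareRate P
        (SAB.agent A B g (fun k => a / ((k : ℝ) + b)) x0 s i) xstar
        (fun k => 1 / (k : ℝ)) 1) := by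
  have hp := SAB.dotProduct_pos hAB hu hv
  have hn : (0 : ℝ) < n := by exact_mod_cast hAB.pos
  have hμ := hobj.μ_pos
  refine ⟨fun a b α ha hb hα hα1 _ => ?_, fun a b ha hb hlow _ => ?_⟩
  · have hm : 0 < dotProduct u v / n ^ 2 * μ := by positivity
    -- Any positive `m'` below the decay rate would do; half of the rate is taken.
    refine (SAB.meanSquareRate_of_slow_steps hobj hAB hu hv hs x0 (fun k => by positivity)
      (fun k => ?_) (SAB.tendsto_div_rpow (by linarith)) (half_lt_self hm)
      (SAB.eventually_div_rpow_sub_le ha hb hα1 (by positivity))).1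
    push_cast
    gcongr
    linarith
  · have hrate : 1 / a < dotProduct u v / n ^ 2 * μ := by
      rw [div_lt_iff₀ (by positivity)] at hlow
      rw [div_mul_eq_mul_div, div_lt_div_iff₀ ha (by positivity)]
      linarith
    have key := SAB.meanSquareRate_of_slow_steps hobj hAB hu hv hs x0
      (α := fun k => a / ((k : ℝ) + b)) (fun k => by positivity)
      (fun k => by push_cast; gcongr; linarith)
      (by simpa using SAB.tendsto_div_rpow (a := a) (b := b) one_pos) hrate
      (Filter.Eventually.of_forall fun k => by
        have ht : 0 < (k : ℝ) + b := by positivity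
        have h1 := SAB.div_rpow_sub_le ha.le ht le_rfl
        have h2 : ((k + 1 : ℕ) : ℝ) + b = ((k : ℝ) + b) + 1 := by push_cast; ring
        rw [Real.rpow_one, Real.rpow_one] at h1
        rw [h2]
        refine h1.trans_eq ?_
        field_simp)
    exact ⟨key.1.of_harmonic ha hb, fun i => (key.2 i).of_harmonic ha hb⟩
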